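/- Let $\mathbb K=\mathbb R$ or $\mathbb C$. Let $S^3\cong SU(2)$ be the group of unit quaternions, with left-invariant vector fields $E^1,E^2,E^3$ normalised by $[E^1,E^2]=-E^3$ and cyclic permutations (explicitly $E^i(q)=-\tfrac12 q\,e_i$ with $e_1,e_2,e_3$ the quaternion units $\mathbf i,\mathbf j,\mathbf k$), and dual forms $\sigma_1,\sigma_2,\sigma_3$, so that $d\sigma_1=\sigma_2\wedge\sigma_3$ cyclically. Let $\Sigma^2=\mathbb R^2$ with coordinates $(r,u)$ and $M=S^3\times\Sigma^2$. All vector fields, forms and metrics on $M$ below are smooth with coefficients in $\mathbb K$ (sections of $TM\otimes\mathbb K$, etc.), metrics being nondegenerate symmetric bilinear forms, and $\alpha\beta=\tfrac12(\alpha\otimes\beta+\beta\otimes\alpha)$ for 1-forms. Let $a_2,c_2,k,s\in\mathbb K$ with $a_2\neq0$, $k\ne0$, $a_2^2+c_2^2\neq0$ and $s^2=a_2^2+c_2^2$ (so $s$ is a choice of $\sqrt{a_2^2+c_2^2}$), and put $f(r)=k\,e^{-(c_2/a_2)r}$. Consider $$X_1=E^2-\frac{\partial}{\partial r},\qquad X_2=a_2E^1+c_2E^3-\frac{s}{f(r)}\frac{\partial}{\partial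 u},\qquad \mathcal D=\operatorname{span}(X_1,X_2),$$ and the coframe $$\omega_1=\sigma_1+\frac{a_2f}{s}du,\quad \omega_2=\sigma_2+dr,\quad \omega_3=\sigma_3+\frac{c_2f}{s}du,\quad \omega_4=dr,\quad \omega_5=-\frac{a_2 f}{s}du .$$ A metric is said to represent Nurowski's conformal class of a rank 2 distribution $\mathcal D$ if near every point it equals $\varphi^2\left(2\theta_1\theta_5-2\theta_2\theta_4+\tfrac43\theta_3\theta_3\right)$ for a nowhere vanishing smooth function $\varphi$ and a coframe $\theta_1,\dots,\theta_5$ with $\mathcal D=\ker\theta_1\cap\ker\theta_2\cap\ker\theta_3$ that satisfies, for some 1-forms $\Omega_1,\dots,\Omega_7$, Cartan's structure equations $$\begin{aligned} d\theta_1&=\theta_1\wedge(2\Omega_1+\Omega_4)+\theta_2\wedge\Omega_2+\theta_3\wedge\theta_4,\\ d\theta_2&=\theta_1\wedge\Omega_3+\theta_2\wedge(\Omega_1+2\Omega_4)+\theta_3\wedge\theta_5,\\ d\theta_3&=\theta_1\wedge\Omega_5+\theta_2\wedge\Omega_6+\theta_3\wedge(\Omega_1+\Omega_4)+\theta_4\wedge\theta_5,\\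 d\theta_4&=\theta_1\wedge\Omega_7+\tfrac43\theta_3\wedge\Omega_6+\theta_4\wedge\Omega_1+\theta_5\wedge\Omega_2,\\ d\theta_5&=\theta_2\wedge\Omega_7-\tfrac43\theta_3\wedge\Omega_5+\theta_4\wedge\Omega_3+\theta_5\wedge\Omega_4. \end{aligned}$$ Then: 1. $X_1$ and $X_2$ are nowhere zero and null with respect to the product metric $\sigma_1\sigma_1+\sigma_2\sigma_2+\sigma_3\sigma_3-dr^2-f(r)^2du^2$. 2. $\mathcal D$ is a $(2,3,5)$-distribution: $\mathcal D$ has rank $2$, $[\mathcal D,\mathcal D]$ has rank $3$ and $[[\mathcal D,\mathcal D],\mathcal D]=TM\otimes\mathbb K$ at every point. 3. The metric $$\tilde g=2\omega_1\omega_5-2\omega_2\omega_4+\frac43\,\frac{a_2^2}{a_2^2+c_2^2}\,\omega_3\omega_3+\frac15\,\frac{a_2^2}{a_2^2+c_2^2}\,\frac{7a_2^2+3c_2^2}{a_2^2}\,(\omega_1\omega_1+\omega_2\omega_2)$$ represents Nurowski's conformal class of $\mathcal D$. 4. The Weyl tensor of $\tilde g$ vanishes identically if and only if $9a_2^2+c_2^2=0$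 or $a_2^2+9c_2^2=0$. -/

import Mathlib

open scoped Manifold ContDiff Quaternion

noncomputable section

namespace SU2Pfaffian

/-! ### The manifold `M = S³ × Σ²` and its left-invariant frame -/

instance factFinrankQuaternion : Fact (Module.finrank ℝ ℍ[ℝ] = 3 + 1) :=
  ⟨Quaternion.finrank_eq_four⟩

/-- The unit three-sphere, as the group of unit quaternions, i.e. `SU(2)`. -/
abbrev S3 : Type := Metric.sphere (0 : ℍ[ℝ]) 1

/-- `M = S³ × Σ²`; the surface `Σ²` carries global coordinates `(r, u) ∈ ℝ × ℝ`. -/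
abbrev M5 : Type := S3 × (ℝ × ℝ)

/-- The model with corners of the (boundaryless) five-manifold `M`. -/
abbrev IM : ModelWithCorners ℝ (EuclideanSpace ℝ (Fin 3) × (ℝ × ℝ))
    (ModelProd (EuclideanSpace ℝ (Fin 3)) (ℝ × ℝ)) :=
  (𝓡 3).prod 𝓘(ℝ, ℝ × ℝ)

/-- The imaginary quaternion units `i, j, k`. -/
def quatUnit : Fin 3 → ℍ[ℝ] := ![⟨0, 1, 0, 0⟩, ⟨0, 0, 1, 0⟩, ⟨0, 0, 0, 1⟩]

/-- The differential of the inclusion `S³ ⊂ ℍ`. -/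
abbrev dIncl (q : S3) : TangentSpace (𝓡 3) q →L[ℝ] ℍ[ℝ] :=
  mvfderiv (𝓡 3) (Subtype.val : S3 → ℍ[ℝ]) q

theorem exists_tangent_one (i : Fin 3) :
    ∃ v : GroupLieAlgebra (𝓡 3) S3, dIncl 1 v = (-(1 / 2 : ℝ)) • quatUnit i := by
  have h := range_mvfderiv_subtypeVal (E := ℍ[ℝ]) (n := 3) (1 : S3)
  have hm : (-(1 / 2 : ℝ)) • quatUnit i ∈ (mvfderiv (𝓡 3) (Subtype.val : S3 → ℍ[ℝ]) 1).range := by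
    rw [h]
    refine Submodule.smul_mem _ _ ?_
    rw [Submodule.mem_orthogonal_singleton_iff_inner_right]
    have hre : (quatUnit i).re = 0 := by fin_cases i <;> rfl
    have h1 : ((1 : S3) : ℍ[ℝ]) = 1 := rfl
    rw [h1, Quaternion.inner_def, one_mul, Quaternion.re_star, hre]
  exact hm

/-- The basis `-i/2, -j/2, -k/2` of the Lie algebra `T₁S³` (under the usual identification
of unit quaternions with `SU(2)` this is `√-1/2` times the Pauli matrices). -/
def lieBasis (i : Fin 3) : GroupLieAlgebra (𝓡 3) S3 := (exists_tangent_one i).choose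

theorem dIncl_lieBasis (i : Fin 3) : dIncl 1 (lieBasis i) = (-(1 / 2 : ℝ)) • quatUnit i :=
  (exists_tangent_one i).choose_spec

/-- The left-invariant vector fields `E¹, E², E³` on `S³` (indexed by `0, 1, 2`), normalised so
that `[E¹, E²] = -E³` cyclically, i.e. so that the dual left-invariant forms satisfy
`dσ₁ = σ₂ ∧ σ₃` cyclically. -/
def leftInv (i : Fin 3) (q : S3) : TangentSpace (𝓡 3) q := mulInvariantVectorField (lieBasis i) q

/-- The global frame `E¹, E², E³, ∂/∂r, ∂/∂u` of `TM`, indexed by `0, 1, 2, 3, 4`. -/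
def frame (a : Fin 5) (p : M5) : TangentSpace IM p :=
  (![(leftInv 0 p.1, ((0 : ℝ), (0 : ℝ))), (leftInv 1 p.1, ((0 : ℝ), (0 : ℝ))),
     (leftInv 2 p.1, ((0 : ℝ), (0 : ℝ))), ((0 : EuclideanSpace ℝ (Fin 3)), ((1 : ℝ), (0 : ℝ))),
     ((0 : EuclideanSpace ℝ (Fin 3)), ((0 : ℝ), (1 : ℝ)))] :
    Fin 5 → EuclideanSpace ℝ (Fin 3) × (ℝ × ℝ)) a

theorem mdifferentiableAt_mul_left (q x : S3) :
    MDifferentiableAt (𝓡 3) (𝓡 3) (fun y : S3 => q * y) x := by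
  have h : ContMDiff (𝓡 3) 𝓘(ℝ, ℍ[ℝ]) 1 (fun y : S3 => (q : ℍ[ℝ]) * (y : ℍ[ℝ])) := by
    have h2 : ContDiff ℝ 1 (fun z : ℍ[ℝ] => (q : ℍ[ℝ]) * z) := by fun_prop
    exact h2.contMDiff.comp contMDiff_coe_sphere
  exact (h.codRestrict_sphere (fun y => (q * y).2)).mdifferentiableAt one_ne_zero

theorem dIncl_leftInv (i : Fin 3) (q : S3) :
    dIncl q (leftInv i q) = (-(1 / 2 : ℝ)) • ((q : ℍ[ℝ]) * quatUnit i) := by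
  have hι : ∀ x : S3, MDifferentiableAt (𝓡 3) 𝓘(ℝ, ℍ[ℝ]) (Subtype.val : S3 → ℍ[ℝ]) x :=
    fun x => (contMDiff_coe_sphere (m := 1) x).mdifferentiableAt one_ne_zero
  have hL : DifferentiableAt ℝ (fun z : ℍ[ℝ] => (q : ℍ[ℝ]) * z) ((1 : S3) : ℍ[ℝ]) := by fun_prop
  have h1 : mfderiv (𝓡 3) 𝓘(ℝ, ℍ[ℝ]) (fun y : S3 => ((q * y : S3) : ℍ[ℝ])) 1 (lieBasis i) =
      mfderiv (𝓡 3) 𝓘(ℝ, ℍ[ℝ]) (Subtype.val : S3 → ℍ[ℝ]) (q * 1)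
        (mfderiv (𝓡 3) (𝓡 3) (fun y : S3 => q * y) 1 (lieBasis i)) :=
    mfderiv_comp_apply (1 : S3) (hι _) (mdifferentiableAt_mul_left q 1) _
  have h2 : mfderiv (𝓡 3) 𝓘(ℝ, ℍ[ℝ]) (fun y : S3 => ((q * y : S3) : ℍ[ℝ])) 1 (lieBasis i) =
      mfderiv 𝓘(ℝ, ℍ[ℝ]) 𝓘(ℝ, ℍ[ℝ]) (fun z : ℍ[ℝ] => (q : ℍ[ℝ]) * z) ((1 : S3) : ℍ[ℝ])
        (mfderiv (𝓡 3) 𝓘(ℝ, ℍ[ℝ]) (Subtype.val : S3 → ℍ[ℝ]) 1 (lieBasis i)) :=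
    mfderiv_comp_apply (1 : S3) hL.mdifferentiableAt (hι _) _
  have h3 : mfderiv 𝓘(ℝ, ℍ[ℝ]) 𝓘(ℝ, ℍ[ℝ]) (fun z : ℍ[ℝ] => (q : ℍ[ℝ]) * z) ((1 : S3) : ℍ[ℝ])
        (mfderiv (𝓡 3) 𝓘(ℝ, ℍ[ℝ]) (Subtype.val : S3 → ℍ[ℝ]) 1 (lieBasis i)) =
      (q : ℍ[ℝ]) * dIncl 1 (lieBasis i) := by
    rw [mfderiv_eq_fderiv]
    have : HasFDerivAt (fun z : ℍ[ℝ] => (q : ℍ[ℝ]) * z)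
      (ContinuousLinearMap.mul ℝ ℍ[ℝ] (q : ℍ[ℝ])) ((1 : S3) : ℍ[ℝ]) :=
      (ContinuousLinearMap.mul ℝ ℍ[ℝ] (q : ℍ[ℝ])).hasFDerivAt
    rw [this.fderiv]
    rfl
  rw [dIncl_lieBasis, mul_smul_comm] at h3
  have h4 : ∀ x : S3, x = q → (mfderiv (𝓡 3) 𝓘(ℝ, ℍ[ℝ]) (Subtype.val : S3 → ℍ[ℝ]) x :
      EuclideanSpace ℝ (Fin 3) →L[ℝ] ℍ[ℝ]) =
      (mfderiv (𝓡 3) 𝓘(ℝ, ℍ[ℝ]) (Subtype.val : S3 → ℍ[ℝ]) q :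
      EuclideanSpace ℝ (Fin 3) →L[ℝ] ℍ[ℝ]) := by
    rintro x rfl; rfl
  have h5 := DFunLike.congr_fun (h4 (q * 1) (mul_one q)) (leftInv i q)
  exact h5.symm.trans (h1.symm.trans (h2.trans h3))

theorem linearIndependent_leftInv (q : S3) :
    LinearIndependent ℝ (fun i : Fin 3 =>
      (leftInv i q : EuclideanSpace ℝ (Fin 3))) := by
  rw [Fintype.linearIndependent_iff]
  intro g hg
  have h : dIncl q (∑ i, g i • leftInv i q) = 0 := by
    have : (∑ i, g i • leftInv i q : TangentSpace (𝓡 3) q) = 0 := hg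
    rw [this, map_zero]
  have h0 : (q : ℍ[ℝ]) ≠ 0 := ne_zero_of_mem_unit_sphere q
  rw [map_sum] at h
  simp only [map_smul, dIncl_leftInv] at h
  have h' : (q : ℍ[ℝ]) * (∑ i, g i • (-(1 / 2 : ℝ)) • quatUnit i) = 0 := by
    refine Eq.trans ?_ h
    rw [Finset.mul_sum]
    refine Finset.sum_congr rfl fun i _ => ?_
    rw [mul_smul_comm, mul_smul_comm]
  have h2 := (mul_eq_zero.mp h').resolve_left h0
  have hI := congrArg (fun z : ℍ[ℝ] => z.imI) h2
  have hJ := congrArg (fun z : ℍ[ℝ] => z.imJ) h2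
  have hK := congrArg (fun z : ℍ[ℝ] => z.imK) h2
  simp only [Fin.sum_univ_three, Quaternion.imI_add, Quaternion.imJ_add, Quaternion.imK_add,
    Quaternion.imI_smul, Quaternion.imJ_smul, Quaternion.imK_smul, Quaternion.imI_zero,
    Quaternion.imJ_zero, Quaternion.imK_zero] at hI hJ hK
  simp [quatUnit] at hI hJ hK
  intro i
  fin_cases i
  · exact hI
  · exact hJ
  · exact hK

theorem linearIndependent_aux (v : Fin 3 → EuclideanSpace ℝ (Fin 3))
    (hv : LinearIndependent ℝ v) :
    LinearIndependent ℝ (![(v 0, ((0 : ℝ), (0 : ℝ))), (v 1, ((0 : ℝ), (0 : ℝ))),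
      (v 2, ((0 : ℝ), (0 : ℝ))), ((0 : EuclideanSpace ℝ (Fin 3)), ((1 : ℝ), (0 : ℝ))),
      ((0 : EuclideanSpace ℝ (Fin 3)), ((0 : ℝ), (1 : ℝ)))] :
      Fin 5 → EuclideanSpace ℝ (Fin 3) × (ℝ × ℝ)) := by
  rw [Fintype.linearIndependent_iff] at hv ⊢
  intro g hg
  have e1 := congrArg (fun z : EuclideanSpace ℝ (Fin 3) × (ℝ × ℝ) => z.1) hg
  have e2 := congrArg (fun z : EuclideanSpace ℝ (Fin 3) × (ℝ × ℝ) => z.2.1) hg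
  have e3 := congrArg (fun z : EuclideanSpace ℝ (Fin 3) × (ℝ × ℝ) => z.2.2) hg
  simp [Fin.sum_univ_five] at e1 e2 e3
  have h4 := hv ![g 0, g 1, g 2] (by simpa [Fin.sum_univ_three] using e1)
  intro a
  fin_cases a
  · exact h4 0
  · exact h4 1
  · exact h4 2
  · exact e2
  · exact e3

theorem linearIndependent_frame (p : M5) :
    LinearIndependent ℝ (fun a : Fin 5 =>
      (frame a p : EuclideanSpace ℝ (Fin 3) × (ℝ × ℝ))) :=
  linearIndependent_aux (fun i => leftInv i p.1) (linearIndependent_leftInv p.1)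

theorem card_eq_finrank :
    Fintype.card (Fin 5) = Module.finrank ℝ (EuclideanSpace ℝ (Fin 3) × (ℝ × ℝ)) := by
  rw [Module.finrank_prod, Module.finrank_prod, finrank_euclideanSpace]
  simp

/-- The frame as a basis of `T_pM`; its dual basis is `σ₁, σ₂, σ₃, dr, du`. -/
def frameBasis (p : M5) : Module.Basis (Fin 5) ℝ (TangentSpace IM p) :=
  basisOfLinearIndependentOfCardEqFinrank
    (V := EuclideanSpace ℝ (Fin 3) × (ℝ × ℝ)) (linearIndependent_frame p)
    card_eq_finrank

theorem frameBasis_apply (p : M5) (a : Fin 5) : frameBasis p a = frame a p := by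
  have h := coe_basisOfLinearIndependentOfCardEqFinrank
    (V := EuclideanSpace ℝ (Fin 3) × (ℝ × ℝ)) (linearIndependent_frame p)
    card_eq_finrank
  exact congrFun h a

/-- The structure functions of the frame: `[e_a, e_b] = ∑ c, structFun a b c • e_c`, where the
bracket is the Lie bracket of vector fields on `M`. -/
def structFun (a b c : Fin 5) (p : M5) : ℝ :=
  (frameBasis p).repr (VectorField.mlieBracket IM (frame a) (frame b) p) c

/-! ### Calculus of `𝕜`-valued tensors (`𝕜 = ℝ` or `ℂ`)

Sections of `TM ⊗ 𝕜` are given by their components in the frame `E¹, E², E³, ∂/∂r, ∂/∂u`, and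
`𝕜`-valued forms by their components in the dual coframe `σ₁, σ₂, σ₃, dr, du`. -/

section Calculus

variable {𝕜 : Type*} [RCLike 𝕜]

/-- The derivative `e_a h` of a function along the `a`-th frame field. -/
def frameDeriv (a : Fin 5) (h : M5 → 𝕜) (p : M5) : 𝕜 := mvfderiv IM h p (frame a p)

/-- Smoothness on `U` of a vector field or 1-form given by its components. -/
def SmoothOn (U : Set M5) (X : M5 → Fin 5 → 𝕜) : Prop :=
  ∀ a, ContMDiffOn IM 𝓘(ℝ, 𝕜) ∞ (fun p => X p a) U

/-- The Lie bracket `[X, Y]` of `𝕜`-valued vector fields. -/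
def lieBr (X Y : M5 → Fin 5 → 𝕜) (p : M5) (c : Fin 5) : 𝕜 :=
  ∑ a, (X p a * frameDeriv a (fun q => Y q c) p - Y p a * frameDeriv a (fun q => X q c) p) +
    ∑ a, ∑ b, X p a * Y p b * (structFun a b c p : 𝕜)

/-- The exterior derivative of a 1-form, evaluated on frame fields:
`dα(e_a, e_b) = e_a(α(e_b)) - e_b(α(e_a)) - α([e_a, e_b])`. -/
def extD (α : M5 → Fin 5 → 𝕜) (p : M5) (a b : Fin 5) : 𝕜 :=
  frameDeriv a (fun q => α q b) p - frameDeriv b (fun q => α q a) p -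
    ∑ c, (structFun a b c p : 𝕜) * α p c

/-- The wedge product of two covectors, `(α ∧ β)(v, w) = α(v) β(w) - α(w) β(v)`. -/
def wedge (α β : Fin 5 → 𝕜) (a b : Fin 5) : 𝕜 := α a * β b - α b * β a

/-- The symmetric product `αβ = (α ⊗ β + β ⊗ α) / 2` of two covectors, as a bilinear form. -/
def symProd (α β : Fin 5 → 𝕜) : Matrix (Fin 5) (Fin 5) 𝕜 :=
  Matrix.of fun a b => (α a * β b + β a * α b) / 2

/-! ### Distributions -/

/-- The distribution spanned by two vector fields. -/
def spanDist (X Y : M5 → Fin 5 → 𝕜) (p : M5) : Submodule 𝕜 (Fin 5 → 𝕜) :=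
  Submodule.span 𝕜 {X p, Y p}

/-- The distribution `[D', D] + D'`, spanned at each point by the values of sections of `D'` and
of brackets of smooth sections of `D` and `D'`. -/
def bracketDist (D D' : M5 → Submodule 𝕜 (Fin 5 → 𝕜)) (p : M5) : Submodule 𝕜 (Fin 5 → 𝕜) :=
  D' p ⊔ Submodule.span 𝕜 {v | ∃ X Y : M5 → Fin 5 → 𝕜, SmoothOn Set.univ X ∧
    SmoothOn Set.univ Y ∧ (∀ q, X q ∈ D q) ∧ (∀ q, Y q ∈ D' q) ∧ v = lieBr X Y p}

/-- A `(2,3,5)`-distribution: `D ⊂ [D, D] ⊂ [[D, D], D] = TM` with ranks 2, 3, 5 everywhere. -/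
def Is235 (D : M5 → Submodule 𝕜 (Fin 5 → 𝕜)) : Prop :=
  ∀ p, Module.finrank 𝕜 (D p) = 2 ∧ Module.finrank 𝕜 (bracketDist D D p) = 3 ∧
    bracketDist D (bracketDist D D) p = ⊤

/-! ### Nurowski's conformal class -/

/-- `θ₁, …, θ₅` (indexed by `0, …, 4`) is a coframe on the open set `U`, adapted to the
distribution `D = ker θ₁ ∩ ker θ₂ ∩ ker θ₃`, which satisfies Cartan's structure equations with
some 1-forms `Ω₁, …, Ω₇` (indexed by `0, …, 6`). -/
structure IsCartanCoframe (D : M5 → Submodule 𝕜 (Fin 5 → 𝕜)) (U : Set M5)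
    (θ : Fin 5 → M5 → Fin 5 → 𝕜) : Prop where
  smooth : ∀ i, SmoothOn U (θ i)
  coframe : ∀ p ∈ U, LinearIndependent 𝕜 (fun i => θ i p)
  annihilates : ∀ p ∈ U, ∀ v, v ∈ D p ↔ θ 0 p ⬝ᵥ v = 0 ∧ θ 1 p ⬝ᵥ v = 0 ∧ θ 2 p ⬝ᵥ v = 0
  structure_eqs : ∃ Ω : Fin 7 → M5 → Fin 5 → 𝕜, (∀ i, SmoothOn U (Ω i)) ∧ ∀ p ∈ U,
    extD (θ 0) p = wedge (θ 0 p) ((2 : 𝕜) • Ω 0 p + Ω 3 p) + wedge (θ 1 p) (Ω 1 p)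
      + wedge (θ 2 p) (θ 3 p) ∧
    extD (θ 1) p = wedge (θ 0 p) (Ω 2 p) + wedge (θ 1 p) (Ω 0 p + (2 : 𝕜) • Ω 3 p)
      + wedge (θ 2 p) (θ 4 p) ∧
    extD (θ 2) p = wedge (θ 0 p) (Ω 4 p) + wedge (θ 1 p) (Ω 5 p)
      + wedge (θ 2 p) (Ω 0 p + Ω 3 p) + wedge (θ 3 p) (θ 4 p) ∧
    extD (θ 3) p = wedge (θ 0 p) (Ω 6 p) + (4 / 3 : 𝕜) • wedge (θ 2 p) (Ω 5 p)
      + wedge (θ 3 p) (Ω 0 p) + wedge (θ 4 p) (Ω 1 p) ∧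
    extD (θ 4) p = wedge (θ 1 p) (Ω 6 p) - (4 / 3 : 𝕜) • wedge (θ 2 p) (Ω 4 p)
      + wedge (θ 3 p) (Ω 2 p) + wedge (θ 4 p) (Ω 3 p)

/-- The metric `2 θ₁ θ₅ - 2 θ₂ θ₄ + (4/3) θ₃ θ₃`. -/
def cartanMetric (θ : Fin 5 → M5 → Fin 5 → 𝕜) (p : M5) : Matrix (Fin 5) (Fin 5) 𝕜 :=
  (2 : 𝕜) • symProd (θ 0 p) (θ 4 p) - (2 : 𝕜) • symProd (θ 1 p) (θ 3 p)
    + (4 / 3 : 𝕜) • symProd (θ 2 p) (θ 2 p)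

/-- A smooth nondegenerate symmetric bilinear form on `TM ⊗ 𝕜`. -/
def IsMetric (g : M5 → Matrix (Fin 5) (Fin 5) 𝕜) : Prop :=
  (∀ a b, ContMDiff IM 𝓘(ℝ, 𝕜) ∞ (fun p => g p a b)) ∧ ∀ p, (g p).IsSymm ∧ (g p).det ≠ 0

/-- The metric `g` represents Nurowski's conformal class of `D`: near every point there is a
Cartan coframe `θ` adapted to `D` such that `g = φ² (2 θ₁ θ₅ - 2 θ₂ θ₄ + (4/3) θ₃ θ₃)` for a
smooth nowhere vanishing function `φ`. -/
def RepresentsNurowski (D : M5 → Submodule 𝕜 (Fin 5 → 𝕜))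
    (g : M5 → Matrix (Fin 5) (Fin 5) 𝕜) : Prop :=
  IsMetric g ∧ ∀ p₀ : M5, ∃ U : Set M5, IsOpen U ∧ p₀ ∈ U ∧
    ∃ θ : Fin 5 → M5 → Fin 5 → 𝕜, IsCartanCoframe D U θ ∧
    ∃ φ : M5 → 𝕜, ContMDiffOn IM 𝓘(ℝ, 𝕜) ∞ φ U ∧
      ∀ p ∈ U, φ p ≠ 0 ∧ g p = φ p ^ 2 • cartanMetric θ p

/-! ### The Weyl tensor -/

section Curvature

variable (g : M5 → Matrix (Fin 5) (Fin 5) 𝕜)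

/-- Koszul's formula for `g(∇_{e_a} e_b, e_c)`, where `∇` is the Levi-Civita connection. -/
def christoffelLow (a b c : Fin 5) (p : M5) : 𝕜 :=
  (frameDeriv a (fun q => g q b c) p + frameDeriv b (fun q => g q a c) p
    - frameDeriv c (fun q => g q a b) p
    + ∑ d, (structFun a b d p : 𝕜) * g p d c - ∑ d, (structFun a c d p : 𝕜) * g p d b
    - ∑ d, (structFun b c d p : 𝕜) * g p d a) / 2

/-- The coefficients of `∇_{e_a} e_b = ∑ c, christoffel a b c • e_c`. -/
def christoffel (a b c : Fin 5) (p : M5) : 𝕜 :=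
  ∑ d, christoffelLow g a b d p * (g p)⁻¹ d c

/-- The components of the curvature `R(e_a, e_b) e_c = ∑ d, riemannUp a b c d • e_d`, where
`R(X, Y) Z = ∇_X ∇_Y Z - ∇_Y ∇_X Z - ∇_{[X, Y]} Z`. -/
def riemannUp (a b c d : Fin 5) (p : M5) : 𝕜 :=
  frameDeriv a (christoffel g b c d) p - frameDeriv b (christoffel g a c d) p
    + ∑ e, (christoffel g b c e p * christoffel g a e d p
      - christoffel g a c e p * christoffel g b e d p
      - (structFun a b e p : 𝕜) * christoffel g e c d p)

/-- `g(R(e_a, e_b) e_c, e_d)`. -/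
def riemannLow (a b c d : Fin 5) (p : M5) : 𝕜 := ∑ e, riemannUp g a b c e p * g p e d

/-- `Ric(e_b, e_c)`, the trace of `X ↦ R(X, e_b) e_c`. -/
def ricci (b c : Fin 5) (p : M5) : 𝕜 := ∑ a, riemannUp g a b c a p

/-- The scalar curvature. -/
def scalarCurv (p : M5) : 𝕜 := ∑ b, ∑ c, (g p)⁻¹ b c * ricci g b c p

/-- The Weyl tensor in dimension five, with all indices lowered. -/
def weyl (a b c d : Fin 5) (p : M5) : 𝕜 :=
  riemannLow g a b c d p
    - (1 / 3) * (ricci g a d p * g p b c - ricci g a c p * g p b d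
      + g p a d * ricci g b c p - g p a c * ricci g b d p)
    + (scalarCurv g p / 12) * (g p a d * g p b c - g p a c * g p b d)

end Curvature

/-! ### The objects of the theorem -/

/-- The warping function `f(r) = k exp(-(c/a) r)`. -/
def warp (a c k : 𝕜) (r : ℝ) : 𝕜 := k * NormedSpace.exp (-(c / a) * (r : 𝕜))

/-- The forms `σ₁, σ₂, σ₃, dr, du` (indexed by `0, …, 4`) dual to the frame. -/
def dualForm (i : Fin 5) (_p : M5) : Fin 5 → 𝕜 := Pi.single i 1

/-- The product metric `σ₁σ₁ + σ₂σ₂ + σ₃σ₃ - dr² - f(r)² du²`. -/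
def productMetric (f : ℝ → 𝕜) (p : M5) : Matrix (Fin 5) (Fin 5) 𝕜 :=
  symProd (dualForm 0 p) (dualForm 0 p) + symProd (dualForm 1 p) (dualForm 1 p)
    + symProd (dualForm 2 p) (dualForm 2 p) - symProd (dualForm 3 p) (dualForm 3 p)
    - f p.2.1 ^ 2 • symProd (dualForm 4 p) (dualForm 4 p)

/-- `X` is nowhere zero and null for `g`. -/
def IsNullField (g : M5 → Matrix (Fin 5) (Fin 5) 𝕜) (X : M5 → Fin 5 → 𝕜) : Prop :=
  ∀ p, X p ≠ 0 ∧ X p ⬝ᵥ (g p).mulVec (X p) = 0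

/-- `X₁ = E² - ∂/∂r`. -/
def X1 (_p : M5) : Fin 5 → 𝕜 := ![0, 1, 0, -1, 0]

/-- `X₂ = a E¹ + c E³ - (s / f(r)) ∂/∂u`, with `s` a square root of `a² + c²`. -/
def X2 (a c s : 𝕜) (f : ℝ → 𝕜) (p : M5) : Fin 5 → 𝕜 := ![a, 0, c, 0, -(s / f p.2.1)]

/-- The coframe `ω₁ = σ₁ + (a f / s) du`, `ω₂ = σ₂ + dr`, `ω₃ = σ₃ + (c f / s) du`, `ω₄ = dr`,
`ω₅ = -(a f / s) du`, indexed by `0, …, 4`. -/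
def omega (a c s : 𝕜) (f : ℝ → 𝕜) (i : Fin 5) (p : M5) : Fin 5 → 𝕜 :=
  (![dualForm 0 p + (a * f p.2.1 / s) • dualForm 4 p,
     dualForm 1 p + dualForm 3 p,
     dualForm 2 p + (c * f p.2.1 / s) • dualForm 4 p,
     dualForm 3 p,
     -((a / s * f p.2.1) • dualForm 4 p)] : Fin 5 → Fin 5 → 𝕜) i

/-- The metric
`2 ω₁ω₅ - 2 ω₂ω₄ + (4/3) (a²/(a²+c²)) ω₃ω₃
  + (1/5) (a²/(a²+c²)) ((7a²+3c²)/a²) (ω₁ω₁ + ω₂ω₂)`. -/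
def gm (a c s : 𝕜) (f : ℝ → 𝕜) (p : M5) : Matrix (Fin 5) (Fin 5) 𝕜 :=
  let w : Fin 5 → Fin 5 → 𝕜 := fun i => omega a c s f i p
  (2 : 𝕜) • symProd (w 0) (w 4) - (2 : 𝕜) • symProd (w 1) (w 3)
    + (4 / 3 * (a ^ 2 / (a ^ 2 + c ^ 2))) • symProd (w 2) (w 2)
    + (1 / 5 * (a ^ 2 / (a ^ 2 + c ^ 2)) * ((7 * a ^ 2 + 3 * c ^ 2) / a ^ 2)) •
      (symProd (w 0) (w 0) + symProd (w 1) (w 1))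

end Calculus

end SU2Pfaffian

end

/-! Write `y = a f / s` and `t = c / a`, so that `dy = -t y dr`. In the frame `E¹, E², E³, ∂_r, ∂_u`
the structure functions are constant, and every tensor coefficient is a constant times a power of
`y`. Each claim thus becomes algebra in `a` and `c`, once the actual Lie brackets on `S³ × ℝ²` are
known (`mlieBracket_frame`).

The distribution is the common kernel of `ω₁, ω₂, ω₃`. Modulo `ω₁, ω₂` one has `dω₁ ≡ ω₃ ∧ ω₄`, `dω₂
≡ ω₃ ∧ ω₅` and `dω₃ ≡ (1 + t²) ω₄ ∧ ω₅`; the exponential form of `f` is what cancels the `ω₄ ∧ ω₅`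
term in `dω₁`. Hence `[D, D] = ker ω₁ ∩ ker ω₂`, and bracketing with `E³` fills the tangent space.

With `m = 1 / (1 + t²)` and `A` the coefficient of `ω₁ω₁ + ω₂ω₂`, the forms `m ω₁, m ω₂, m ω₃, ω₄ -
(A/2) ω₂, ω₅ + (A/2) ω₁` satisfy Cartan's equations when `5 A = 3 + 4 m`. Their Cartan metric is `m`
times the given one, and `1 / m = (s / a)²`.

For the Weyl tensor, one component suffices in one direction: `W(E¹, ∂_u, E², ∂_r)` is `y` times a
nonzero multiple of `(9a² + c²)(a² + 9c²)` (`weyl_gm_eq`). Conversely, if that product vanishes then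
`t = 3i` or `t = i/3` with `i² = -1`. Dividing the frame by `1, i, i, i, y` then makes all
coefficients rational, and the vanishing of the whole Weyl tensor is a finite rational computation
(`IsScaling.weyl_eq`, `weyl_gm_eq_zero`). -/

noncomputable section

namespace SU2Pfaffian

/-! ### Lie brackets of vector fields as commutators of derivations. -/

section LieBracket

variable {E : Type*} [NormedAddCommGroup E] [NormedSpace ℝ E]
  {H : Type*} [TopologicalSpace H] {I : ModelWithCorners ℝ E H}
  {M : Type*} [TopologicalSpace M] [ChartedSpace H M]
  {F : Type*} [NormedAddCommGroup F] [NormedSpace ℝ F]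

/-- The derivative of a function along a vector field, read in a chart. -/
theorem fderivWithin_comp_extChartAt_symm_mpullbackWithin [IsManifold I 1 M] {x : M} {f : M → F}
    {y : E} (hy : y ∈ (extChartAt I x).target)
    (hf : MDifferentiableAt I 𝓘(ℝ, F) f ((extChartAt I x).symm y))
    (V : Π z : M, TangentSpace I z) :
    fderivWithin ℝ (f ∘ (extChartAt I x).symm) (Set.range I) y
        (VectorField.mpullbackWithin 𝓘(ℝ, E) I (extChartAt I x).symm V (Set.range I) y) =
      mvfderiv I f ((extChartAt I x).symm y) (V ((extChartAt I x).symm y)) := by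
  have hyr : y ∈ Set.range I := extChartAt_target_subset_range x hy
  have h1 := mfderiv_comp_mfderivWithin y hf
    (mdifferentiableWithinAt_extChartAt_symm (I := I) hy)
    (I.uniqueDiffOn y hyr).uniqueMDiffWithinAt
  rw [mfderivWithin_eq_fderivWithin] at h1
  have h2 := DFunLike.congr_fun h1
    (VectorField.mpullbackWithin 𝓘(ℝ, E) I (extChartAt I x).symm V (Set.range I) y)
  refine h2.trans ?_
  rw [VectorField.mpullbackWithin_apply]
  -- The pullback applies the inverse of the derivative of the inverse chart, so that derivative
  -- undoes it.
  have h3 : (mfderivWithin 𝓘(ℝ, E) I (extChartAt I x).symm (Set.range I) y)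
      ((mfderivWithin 𝓘(ℝ, E) I (extChartAt I x).symm (Set.range I) y).inverse
        (V ((extChartAt I x).symm y))) = V ((extChartAt I x).symm y) :=
    (isInvertible_mfderivWithin_extChartAt_symm hy).self_apply_inverse _
  exact congrArg (mfderiv I 𝓘(ℝ, F) f ((extChartAt I x).symm y)) h3

/-- On functions, the Lie bracket acts as the commutator of the derivations. -/
theorem mvfderiv_mlieBracket [CompleteSpace E] [IsManifold I 2 M] {x : M} {f : M → F}
    {V W : Π z : M, TangentSpace I z} (hf : ContMDiff I 𝓘(ℝ, F) 2 f)
    (hV : MDifferentiableAt I I.tangent (fun z => (V z : TangentBundle I M)) x)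
    (hW : MDifferentiableAt I I.tangent (fun z => (W z : TangentBundle I M)) x)
    (hVf : MDifferentiableAt I 𝓘(ℝ, F) (fun z => mvfderiv I f z (V z)) x)
    (hWf : MDifferentiableAt I 𝓘(ℝ, F) (fun z => mvfderiv I f z (W z)) x) :
    mvfderiv I f x (VectorField.mlieBracket I V W x) =
      mvfderiv I (fun z => mvfderiv I f z (W z)) x (V x) -
        mvfderiv I (fun z => mvfderiv I f z (V z)) x (W x) := by
  have : IsManifold I 1 M := IsManifold.of_le (n := 2) one_le_two
  set φ := extChartAt I x with hφ
  have hx : φ x ∈ φ.target := mem_extChartAt_target x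
  have hxr : φ x ∈ Set.range I := extChartAt_target_subset_range x hx
  have hinv : φ.symm (φ x) = x := extChartAt_to_inv x
  set V' : E → E := VectorField.mpullbackWithin 𝓘(ℝ, E) I φ.symm V (Set.range I) with hV'
  set W' : E → E := VectorField.mpullbackWithin 𝓘(ℝ, E) I φ.symm W (Set.range I) with hW'
  have hfd : ∀ z, MDifferentiableAt I 𝓘(ℝ, F) f z := fun z =>
    (hf z).mdifferentiableAt two_ne_zero
  have key : ∀ U : Π z : M, TangentSpace I z,
      (fun y => fderivWithin ℝ (f ∘ φ.symm) (Set.range I) y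
        (VectorField.mpullbackWithin 𝓘(ℝ, E) I φ.symm U (Set.range I) y))
      =ᶠ[nhdsWithin (φ x) (Set.range I)] (fun z => mvfderiv I f z (U z)) ∘ φ.symm := by
    intro U
    filter_upwards [extChartAt_target_mem_nhdsWithin (I := I) x] with y hy
    exact fderivWithin_comp_extChartAt_symm_mpullbackWithin hy (hfd _) U
  have hfs : ContDiffWithinAt ℝ 2 (f ∘ φ.symm) (Set.range I) (φ x) := by
    have := (contMDiffAt_iff.1 (hf x)).2
    exact this
  have hbr : mvfderiv I f x (VectorField.mlieBracket I V W x) =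
      fderivWithin ℝ (f ∘ φ.symm) (Set.range I) (φ x)
        (VectorField.lieBracketWithin ℝ V' W' (Set.range I) (φ x)) := by
    have h0 : VectorField.mlieBracket I V W x =
        VectorField.lieBracketWithin ℝ V' W' (Set.range I) (φ x) := by
      -- The tangent space at `x` is read in the preferred chart at `x`, so this chart has identity
      -- derivative there and the manifold bracket is the bracket of the chart representatives.
      have hi : ContinuousLinearMap.inverse (mfderiv I 𝓘(ℝ, E) φ x : E →L[ℝ] E) =
          ContinuousLinearMap.id ℝ E :=
        (congrArg (fun L : E →L[ℝ] E => L.inverse) (mfderiv_extChartAt_self (I := I) (x := x))).trans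
          ContinuousLinearMap.inverse_id
      rw [← VectorField.mlieBracketWithin_univ, VectorField.mlieBracketWithin_apply,
        Set.preimage_univ, Set.univ_inter]
      exact DFunLike.congr_fun hi _
    rw [h0, (hfd x).mvfderiv]
    rfl
  rw [hbr, VectorField.fderivWithin_apply_lieBracket (n := 2) hfs (by simp) I.uniqueDiffOn
    (I.range_subset_closure_interior hxr) hxr ?_ ?_]
  · rw [(key V).fderivWithin_eq_of_mem hxr, (key W).fderivWithin_eq_of_mem hxr]
    have e1 := fderivWithin_comp_extChartAt_symm_mpullbackWithin (I := I) (x := x)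
      (f := fun z => mvfderiv I f z (W z)) hx (by rw [hinv]; exact hWf) V
    have e2 := fderivWithin_comp_extChartAt_symm_mpullbackWithin (I := I) (x := x)
      (f := fun z => mvfderiv I f z (V z)) hx (by rw [hinv]; exact hVf) W
    rw [hinv] at e1 e2
    rw [← e1, ← e2]
  · have := MDifferentiableWithinAt.differentiableWithinAt_mpullbackWithin_vectorField
      (s := Set.univ) hW.mdifferentiableWithinAt
    simp only [Set.preimage_univ, Set.univ_inter] at this
    exact this
  · have := MDifferentiableWithinAt.differentiableWithinAt_mpullbackWithin_vectorField
      (s := Set.univ) hV.mdifferentiableWithinAt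
    simp only [Set.preimage_univ, Set.univ_inter] at this
    exact this

end LieBracket

/-! ### The Lie group `S³` and smoothness of the frame. -/

/-- Both operations restrict analytic maps of the quaternions and land in the sphere. The structure
is what makes the invariant vector fields smooth enough to bracket. -/
instance lieGroupS3 : LieGroup (𝓡 3) ω S3 where
  contMDiff_mul := by
    have h : ContMDiff ((𝓡 3).prod (𝓡 3)) 𝓘(ℝ, ℍ[ℝ]) ω
        (fun p : S3 × S3 => (p.1 : ℍ[ℝ]) * (p.2 : ℍ[ℝ])) := by
      have h2 : ContDiff ℝ ω (fun z : ℍ[ℝ] × ℍ[ℝ] => z.1 * z.2) := by fun_prop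
      exact h2.contMDiff.comp ((contMDiff_coe_sphere.comp contMDiff_fst).prodMk_space
        (contMDiff_coe_sphere.comp contMDiff_snd))
    exact h.codRestrict_sphere (fun p => (p.1 * p.2).2)
  contMDiff_inv := by
    have h : ContMDiff (𝓡 3) 𝓘(ℝ, ℍ[ℝ]) ω (fun q : S3 => ((q⁻¹ : S3) : ℍ[ℝ])) := by
      intro q
      have h2 := contDiffAt_ringInverse ℝ (n := ω)
        (Units.mk0 (q : ℍ[ℝ]) (ne_zero_of_mem_unit_sphere q))
      rw [Ring.inverse_eq_inv'] at h2
      exact h2.contMDiffAt.comp (g := fun z : ℍ[ℝ] => z⁻¹) q (contMDiff_coe_sphere q)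
    exact h.codRestrict_sphere (fun q => (q⁻¹).2)

theorem contMDiff_leftInv (i : Fin 3) :
    ContMDiff (𝓡 3) (𝓡 3).tangent 2 (fun q => (leftInv i q : TangentBundle (𝓡 3) S3)) := by
  have h := contMDiff_mulInvariantVectorField (I := 𝓡 3) (G := S3) (lieBasis i)
  exact h.of_le le_minSmoothness

theorem contMDiff_productField {v : Π q : S3, TangentSpace (𝓡 3) q} {w : ℝ × ℝ}
    (hv : ContMDiff (𝓡 3) (𝓡 3).tangent 2 (fun q => (v q : TangentBundle (𝓡 3) S3))) :
    ContMDiff IM IM.tangent 2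
      (fun p : M5 => (⟨p, (v p.1, w)⟩ : TangentBundle IM M5)) := by
  have h1 : ContMDiff IM 𝓘(ℝ, ℝ × ℝ).tangent 2
      (fun p : M5 => (⟨p.2, w⟩ : TangentBundle 𝓘(ℝ, ℝ × ℝ) (ℝ × ℝ))) := by
    have h2 : ContMDiff 𝓘(ℝ, ℝ × ℝ) 𝓘(ℝ, ℝ × ℝ).tangent 2
        (fun x : ℝ × ℝ => (⟨x, w⟩ : TangentBundle 𝓘(ℝ, ℝ × ℝ) (ℝ × ℝ))) :=
      contMDiff_vectorSpace_iff_contDiff.2 contDiff_const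
    exact h2.comp contMDiff_snd
  exact contMDiff_equivTangentBundleProd_symm.comp ((hv.comp contMDiff_fst).prodMk h1)

theorem contMDiff_frame (a : Fin 5) :
    ContMDiff IM IM.tangent 2 (fun p => (frame a p : TangentBundle IM M5)) := by
  have h0 : ContMDiff (𝓡 3) (𝓡 3).tangent 2
      (fun q : S3 => ((0 : TangentSpace (𝓡 3) q) : TangentBundle (𝓡 3) S3)) :=
    Bundle.contMDiff_zeroSection _ _
  fin_cases a
  · exact contMDiff_productField (w := (0, 0)) (contMDiff_leftInv 0)
  · exact contMDiff_productField (w := (0, 0)) (contMDiff_leftInv 1)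
  · exact contMDiff_productField (w := (0, 0)) (contMDiff_leftInv 2)
  · exact contMDiff_productField (w := (1, 0)) h0
  · exact contMDiff_productField (w := (0, 1)) h0

/-! ### Brackets of the frame fields, computed in `ℍ × ℝ²`. -/

section FrameBracket

variable {F : Type*} [NormedAddCommGroup F] [NormedSpace ℝ F]

theorem mvfderiv_comp_fst {h : S3 → F} {p : M5} (hh : MDifferentiableAt (𝓡 3) 𝓘(ℝ, F) h p.1)
    (v : TangentSpace IM p) :
    mvfderiv IM (fun q : M5 => h q.1) p v = mvfderiv (𝓡 3) h p.1 (v : _ × _).1 := by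
  have h1 := mfderiv_comp_apply (I := IM) p hh mdifferentiableAt_fst v
  rw [mfderiv_fst] at h1
  exact h1

theorem mvfderiv_comp_snd {h : ℝ × ℝ → F} {p : M5} (hh : DifferentiableAt ℝ h p.2)
    (v : TangentSpace IM p) :
    mvfderiv IM (fun q : M5 => h q.2) p v = fderiv ℝ h p.2 (v : _ × _).2 := by
  have h1 := mfderiv_comp_apply (I := IM) p hh.mdifferentiableAt mdifferentiableAt_snd v
  rw [mfderiv_snd, mfderiv_eq_fderiv] at h1
  exact h1

/-- The quaternion `e` for which a frame field is `q ↦ -q e / 2` on the sphere. -/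
def frameQuat : Fin 5 → ℍ[ℝ] := ![quatUnit 0, quatUnit 1, quatUnit 2, 0, 0]

/-- The constant `ℝ²`-component of a frame field. -/
def framePlane : Fin 5 → ℝ × ℝ := ![(0, 0), (0, 0), (0, 0), (1, 0), (0, 1)]

theorem mdifferentiableAt_coe_S3 (q : S3) :
    MDifferentiableAt (𝓡 3) 𝓘(ℝ, ℍ[ℝ]) (Subtype.val : S3 → ℍ[ℝ]) q :=
  (contMDiff_coe_sphere (m := 1) q).mdifferentiableAt one_ne_zero

theorem dIncl_frame (a : Fin 5) (p : M5) :
    dIncl p.1 (frame a p : _ × _).1 = (-(1 / 2 : ℝ)) • ((p.1 : ℍ[ℝ]) * frameQuat a) := by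
  fin_cases a
  · exact dIncl_leftInv 0 p.1
  · exact dIncl_leftInv 1 p.1
  · exact dIncl_leftInv 2 p.1
  · refine (map_zero (dIncl p.1)).trans ?_
    simp [frameQuat]
  · refine (map_zero (dIncl p.1)).trans ?_
    simp [frameQuat]

theorem frame_snd (a : Fin 5) (p : M5) : (frame a p : _ × _).2 = framePlane a := by
  fin_cases a <;> rfl

theorem mvfderiv_sphereCoord_frame (a : Fin 5) (p : M5) :
    mvfderiv IM (fun q : M5 => (q.1 : ℍ[ℝ])) p (frame a p) =
      (-(1 / 2 : ℝ)) • ((p.1 : ℍ[ℝ]) * frameQuat a) :=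
  (mvfderiv_comp_fst (mdifferentiableAt_coe_S3 p.1) _).trans (dIncl_frame a p)

theorem mvfderiv_planeCoord_frame (a : Fin 5) (p : M5) :
    mvfderiv IM (fun q : M5 => q.2) p (frame a p) = framePlane a := by
  have h := mvfderiv_comp_snd (h := fun x : ℝ × ℝ => x) (p := p) differentiableAt_id (frame a p)
  rw [frame_snd] at h
  simpa using h

theorem contMDiff_sphereCoord {n : ℕ∞ω} :
    ContMDiff IM 𝓘(ℝ, ℍ[ℝ]) n (fun q : M5 => (q.1 : ℍ[ℝ])) :=
  contMDiff_coe_sphere.comp contMDiff_fst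

theorem mvfderiv_clm_sphereCoord_frame (L : ℍ[ℝ] →L[ℝ] ℍ[ℝ]) (a : Fin 5) (p : M5) :
    mvfderiv IM (fun q : M5 => L (q.1 : ℍ[ℝ])) p (frame a p) =
      L ((-(1 / 2 : ℝ)) • ((p.1 : ℍ[ℝ]) * frameQuat a)) := by
  have hL : MDifferentiableAt 𝓘(ℝ, ℍ[ℝ]) 𝓘(ℝ, ℍ[ℝ]) (fun z => L z) (p.1 : ℍ[ℝ]) :=
    L.differentiableAt.mdifferentiableAt
  have h := mfderiv_comp_apply (I := IM) p hL
    ((contMDiff_sphereCoord (n := 1) p).mdifferentiableAt one_ne_zero) (frame a p)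
  rw [mfderiv_eq_fderiv, L.fderiv] at h
  refine h.trans (congrArg L (mvfderiv_sphereCoord_frame a p))

theorem mdifferentiableAt_frame (a : Fin 5) (p : M5) :
    MDifferentiableAt IM IM.tangent (fun p => (frame a p : TangentBundle IM M5)) p :=
  (contMDiff_frame a p).mdifferentiableAt two_ne_zero

/-- A frame field sends the embedding `q` to `-q e / 2`, a linear function of `q`, so the commutator
of two such derivations is a commutator of right multiplications. -/
theorem mvfderiv_sphereCoord_mlieBracket (a b : Fin 5) (p : M5) :
    mvfderiv IM (fun q : M5 => (q.1 : ℍ[ℝ])) p (VectorField.mlieBracket IM (frame a) (frame b) p) =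
      (1 / 4 : ℝ) • ((p.1 : ℍ[ℝ]) * (frameQuat a * frameQuat b - frameQuat b * frameQuat a)) := by
  have hc : ∀ c, (fun q : M5 => mvfderiv IM (fun q : M5 => (q.1 : ℍ[ℝ])) q (frame c q)) =
      fun q : M5 => ((-(1 / 2 : ℝ)) • (ContinuousLinearMap.mul ℝ ℍ[ℝ]).flip (frameQuat c))
        (q.1 : ℍ[ℝ]) := fun c => by
    funext q
    rw [mvfderiv_sphereCoord_frame]
    rfl
  have hd : ∀ c, MDifferentiableAt IM 𝓘(ℝ, ℍ[ℝ])
      (fun q : M5 => mvfderiv IM (fun q : M5 => (q.1 : ℍ[ℝ])) q (frame c q)) p := fun c => by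
    rw [hc]
    exact (ContinuousLinearMap.differentiableAt _).mdifferentiableAt.comp p
      ((contMDiff_sphereCoord (n := 1) p).mdifferentiableAt one_ne_zero)
  rw [mvfderiv_mlieBracket contMDiff_sphereCoord (mdifferentiableAt_frame a p)
    (mdifferentiableAt_frame b p) (hd a) (hd b), hc, hc, mvfderiv_clm_sphereCoord_frame,
    mvfderiv_clm_sphereCoord_frame]
  simp only [smul_apply, ContinuousLinearMap.flip_apply,
    ContinuousLinearMap.mul_apply', smul_mul_assoc, smul_smul, mul_sub, mul_assoc, smul_sub]
  norm_num

theorem mvfderiv_planeCoord_mlieBracket (a b : Fin 5) (p : M5) :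
    mvfderiv IM (fun q : M5 => q.2) p (VectorField.mlieBracket IM (frame a) (frame b) p) = 0 := by
  have hc : ∀ c, (fun q : M5 => mvfderiv IM (fun q : M5 => q.2) q (frame c q)) =
      fun _ => framePlane c := fun c => funext fun q => mvfderiv_planeCoord_frame c q
  have hd : ∀ c, MDifferentiableAt IM 𝓘(ℝ, ℝ × ℝ)
      (fun q : M5 => mvfderiv IM (fun q : M5 => q.2) q (frame c q)) p := fun c => by
    rw [hc]
    exact mdifferentiableAt_const
  rw [mvfderiv_mlieBracket contMDiff_snd (mdifferentiableAt_frame a p)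
    (mdifferentiableAt_frame b p) (hd a) (hd b), hc, hc, mvfderiv_const, mvfderiv_const]
  simp

/-- A tangent vector is determined by its image under the inclusion `M ⊂ ℍ × ℝ²`. -/
theorem tangent_ext {p : M5} {v w : TangentSpace IM p}
    (h1 : mvfderiv IM (fun q : M5 => (q.1 : ℍ[ℝ])) p v =
      mvfderiv IM (fun q : M5 => (q.1 : ℍ[ℝ])) p w)
    (h2 : mvfderiv IM (fun q : M5 => q.2) p v = mvfderiv IM (fun q : M5 => q.2) p w) : v = w := by
  rw [mvfderiv_comp_fst (mdifferentiableAt_coe_S3 p.1),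
    mvfderiv_comp_fst (mdifferentiableAt_coe_S3 p.1)] at h1
  rw [mvfderiv_comp_snd (h := fun x : ℝ × ℝ => x) differentiableAt_id,
    mvfderiv_comp_snd (h := fun x : ℝ × ℝ => x) differentiableAt_id] at h2
  refine Prod.ext (injective_mvfderiv_subtypeVal_sphere p.1 h1) ?_
  simpa using h2

/-- The structure constants of the frame. -/
def structConst (a b c : Fin 5) : ℤ :=
  if (a, b, c) = (0, 1, 2) ∨ (a, b, c) = (1, 2, 0) ∨ (a, b, c) = (2, 0, 1) then -1
  else if (a, b, c) = (1, 0, 2) ∨ (a, b, c) = (2, 1, 0) ∨ (a, b, c) = (0, 2, 1) then 1 else 0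

theorem frameQuat_re (a : Fin 5) : (frameQuat a).re = 0 := by
  fin_cases a <;> rfl

theorem frameQuat_imI (a : Fin 5) : (frameQuat a).imI = ![1, 0, 0, 0, 0] a := by
  fin_cases a <;> rfl

theorem frameQuat_imJ (a : Fin 5) : (frameQuat a).imJ = ![0, 1, 0, 0, 0] a := by
  fin_cases a <;> rfl

theorem frameQuat_imK (a : Fin 5) : (frameQuat a).imK = ![0, 0, 1, 0, 0] a := by
  fin_cases a <;> rfl

/-- For the quaternion units, `(ij - ji) / 4 = k / 2 = -(-k / 2)`: this is the source of the minus
sign in `[E¹, E²] = -E³`. -/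
theorem frameQuat_commutator (a b : Fin 5) :
    (1 / 4 : ℝ) • (frameQuat a * frameQuat b - frameQuat b * frameQuat a) =
      ∑ c, (structConst a b c : ℝ) • ((-(1 / 2 : ℝ)) • frameQuat c) := by
  rw [Fin.sum_univ_five]
  ext
  · simp [frameQuat_re, frameQuat_imI, frameQuat_imJ, frameQuat_imK]
    ring
  all_goals
    simp only [Quaternion.imI_add, Quaternion.imJ_add, Quaternion.imK_add, Quaternion.imI_sub,
      Quaternion.imJ_sub, Quaternion.imK_sub, Quaternion.imI_smul, Quaternion.imJ_smul,
      Quaternion.imK_smul, Quaternion.imI_mul, Quaternion.imJ_mul, Quaternion.imK_mul,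
      frameQuat_re, frameQuat_imI, frameQuat_imJ, frameQuat_imK]
    fin_cases a <;> fin_cases b <;> simp [structConst] <;> norm_num

theorem structConst_framePlane (a b : Fin 5) :
    ∑ c, (structConst a b c : ℝ) • framePlane c = 0 := by
  fin_cases a <;> fin_cases b <;> simp [framePlane, structConst]

theorem mlieBracket_frame (a b : Fin 5) (p : M5) :
    VectorField.mlieBracket IM (frame a) (frame b) p =
      ∑ c, (structConst a b c : ℝ) • frame c p := by
  apply tangent_ext
  · rw [mvfderiv_sphereCoord_mlieBracket, map_sum]
    simp only [map_smul, mvfderiv_sphereCoord_frame]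
    rw [← mul_smul_comm, frameQuat_commutator, Finset.mul_sum]
    simp only [mul_smul_comm]
  · rw [mvfderiv_planeCoord_mlieBracket, map_sum]
    simp only [map_smul, mvfderiv_planeCoord_frame]
    rw [structConst_framePlane]

theorem structFun_eq (a b c : Fin 5) (p : M5) : structFun a b c p = structConst a b c := by
  rw [structFun, mlieBracket_frame]
  simp only [← frameBasis_apply]
  rw [(frameBasis p).repr_sum_self]

end FrameBracket

/-! ### Derivatives of scalar functions along the frame. -/

section FrameDeriv

variable {𝕜 : Type*} [RCLike 𝕜]

theorem frameDeriv_const (a : Fin 5) (k : 𝕜) (p : M5) : frameDeriv a (fun _ => k) p = 0 := by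
  rw [frameDeriv, mvfderiv_const]; rfl

theorem frameDeriv_radial (a : Fin 5) {h : ℝ → 𝕜} {h' : 𝕜} {p : M5} (hh : HasDerivAt h h' p.2.1) :
    frameDeriv a (fun q => h q.2.1) p = if a = 3 then h' else 0 := by
  have h1 : HasFDerivAt (fun x : ℝ × ℝ => h x.1) _ p.2 := hh.hasFDerivAt.comp p.2 hasFDerivAt_fst
  rw [frameDeriv, mvfderiv_comp_snd h1.differentiableAt, h1.fderiv, frame_snd]
  fin_cases a <;> simp [framePlane]

theorem frameDeriv_add (a : Fin 5) {g h : M5 → 𝕜} {p : M5} (hg : MDifferentiableAt IM 𝓘(ℝ, 𝕜) g p)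
    (hh : MDifferentiableAt IM 𝓘(ℝ, 𝕜) h p) :
    frameDeriv a (fun q => g q + h q) p = frameDeriv a g p + frameDeriv a h p := by
  have := mvfderiv_add hg hh
  exact DFunLike.congr_fun this (frame a p)

theorem frameDeriv_mul (a : Fin 5) {g h : M5 → 𝕜} {p : M5} (hg : MDifferentiableAt IM 𝓘(ℝ, 𝕜) g p)
    (hh : MDifferentiableAt IM 𝓘(ℝ, 𝕜) h p) :
    frameDeriv a (fun q => g q * h q) p = g p * frameDeriv a h p + h p * frameDeriv a g p := by
  have := (hg.hasMFDerivAt.mul' hh.hasMFDerivAt).mfderiv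
  refine (DFunLike.congr_fun this (frame a p)).trans ?_
  exact congrArg (g p * frameDeriv a h p + ·) (mul_comm (frameDeriv a g p) (h p))

end FrameDeriv

/-! ### Curvature in a frame with constant structure functions and constant metric coefficients -/

section Algebra

variable {K : Type*} [Field K]

/-- The lowered connection coefficients of a metric `G` in a frame with structure constants `S`,
where `δ a * w` is the logarithmic derivative along `e_a` of a function of weight `w`. -/
def koszul (G : Fin 5 → Fin 5 → K) (S : Fin 5 → Fin 5 → Fin 5 → K) (δ w : Fin 5 → K)
    (a b c : Fin 5) : K :=
  (δ a * (w b + w c) * G b c + δ b * (w a + w c) * G a c - δ c * (w a + w b) * G a b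
    + ∑ d, S a b d * G d c - ∑ d, S a c d * G d b - ∑ d, S b c d * G d a) / 2

/-- Raising the last index. -/
def raiseIndex (L : Fin 5 → Fin 5 → Fin 5 → K) (I : Fin 5 → Fin 5 → K) (a b c : Fin 5) : K :=
  ∑ d, L a b d * I d c

/-- The curvature of the connection with coefficients `Γ`. -/
def curvature (Γ S : Fin 5 → Fin 5 → Fin 5 → K) (δ w : Fin 5 → K) (a b c d : Fin 5) : K :=
  δ a * (w b + w c - w d) * Γ b c d - δ b * (w a + w c - w d) * Γ a c d
    + ∑ e, (Γ b c e * Γ a e d - Γ a c e * Γ b e d - S a b e * Γ e c d)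

/-- The Weyl tensor of a curvature tensor `R` with Ricci tensor `Ric` and scalar curvature `s`. -/
def weylPart (G : Fin 5 → Fin 5 → K) (R : Fin 5 → Fin 5 → Fin 5 → Fin 5 → K)
    (Ric : Fin 5 → Fin 5 → K) (s : K) (a b c d : Fin 5) : K :=
  ∑ e, R a b c e * G e d
    - (1 / 3) * (Ric a d * G b c - Ric a c * G b d + G a d * Ric b c - G a c * Ric b d)
    + (s / 12) * (G a d * G b c - G a c * G b d)

end Algebra

section Scaling

variable {𝕜 : Type*} [RCLike 𝕜]

/-- Nowhere vanishing functions `ρ a` with `e_a ρ_b = δ_a w_b ρ_a ρ_b`. -/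
structure IsScaling (ρ : Fin 5 → M5 → 𝕜) (δ w : Fin 5 → 𝕜) : Prop where
  ne_zero : ∀ a p, ρ a p ≠ 0
  mdifferentiableAt : ∀ a p, MDifferentiableAt IM 𝓘(ℝ, 𝕜) (ρ a) p
  deriv : ∀ a b p, frameDeriv a (ρ b) p = δ a * w b * ρ a p * ρ b p

theorem mdifferentiableAt_inv {h : M5 → 𝕜} {p : M5} (hh : MDifferentiableAt IM 𝓘(ℝ, 𝕜) h p)
    (h0 : h p ≠ 0) : MDifferentiableAt IM 𝓘(ℝ, 𝕜) (fun q => (h q)⁻¹) p :=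
  have h1 : DifferentiableAt ℝ (fun x : 𝕜 => x⁻¹) (h p) :=
    (differentiableAt_inv (𝕜 := 𝕜) h0).restrictScalars ℝ
  h1.mdifferentiableAt.comp p hh

theorem frameDeriv_const_mul (a : Fin 5) (k : 𝕜) {h : M5 → 𝕜} {p : M5}
    (hh : MDifferentiableAt IM 𝓘(ℝ, 𝕜) h p) :
    frameDeriv a (fun q => k * h q) p = k * frameDeriv a h p := by
  rw [frameDeriv_mul a mdifferentiableAt_const hh, frameDeriv_const, mul_zero, add_zero]

namespace IsScaling

variable {ρ : Fin 5 → M5 → 𝕜} {δ w : Fin 5 → 𝕜} (hρ : IsScaling ρ δ w)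

include hρ

theorem frameDeriv_mul_mul (K : 𝕜) (a b c : Fin 5) (p : M5) :
    frameDeriv a (fun q => K * (ρ b q * ρ c q)) p =
      δ a * (w b + w c) * K * (ρ a p * ρ b p * ρ c p) := by
  have hbc : MDifferentiableAt IM 𝓘(ℝ, 𝕜) (fun q => ρ b q * ρ c q) p :=
    (hρ.mdifferentiableAt b p).mul (hρ.mdifferentiableAt c p)
  rw [frameDeriv_const_mul a K hbc,
    frameDeriv_mul a (hρ.mdifferentiableAt b p) (hρ.mdifferentiableAt c p), hρ.deriv, hρ.deriv]
  ring

/-- The inverse of a function of weight `w` has weight `-w`, as differentiating `ρ ρ⁻¹ = 1` shows.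
Connection coefficients have this shape: two lower indices and one upper. -/
theorem frameDeriv_mul_div (K : 𝕜) (a b c d : Fin 5) (p : M5) :
    frameDeriv a (fun q => K * (ρ b q * ρ c q * (ρ d q)⁻¹)) p =
      δ a * (w b + w c - w d) * K * (ρ a p * ρ b p * ρ c p * (ρ d p)⁻¹) := by
  have hd := hρ.ne_zero d p
  have hi := mdifferentiableAt_inv (hρ.mdifferentiableAt d p) hd
  have hbc : MDifferentiableAt IM 𝓘(ℝ, 𝕜) (fun q => ρ b q * ρ c q) p :=
    (hρ.mdifferentiableAt b p).mul (hρ.mdifferentiableAt c p)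
  have hbcd : MDifferentiableAt IM 𝓘(ℝ, 𝕜) (fun q => ρ b q * ρ c q * (ρ d q)⁻¹) p := hbc.mul hi
  have h1 : frameDeriv a (fun q => (ρ d q)⁻¹) p = -(δ a * w d * ρ a p * (ρ d p)⁻¹) := by
    have h2 := frameDeriv_mul a (hρ.mdifferentiableAt d p) hi
    have h3 : (fun q => ρ d q * (ρ d q)⁻¹) = fun _ => (1 : 𝕜) :=
      funext fun q => mul_inv_cancel₀ (hρ.ne_zero d q)
    rw [h3, frameDeriv_const, hρ.deriv] at h2
    have h4 : ρ d p * (frameDeriv a (fun q => (ρ d q)⁻¹) p + δ a * w d * ρ a p * (ρ d p)⁻¹) = 0 := by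
      rw [mul_add, h2]
      ring
    exact eq_neg_of_add_eq_zero_left ((mul_eq_zero.1 h4).resolve_left hd)
  rw [frameDeriv_const_mul a K hbcd, frameDeriv_mul a hbc hi, h1,
    frameDeriv_mul a (hρ.mdifferentiableAt b p) (hρ.mdifferentiableAt c p), hρ.deriv, hρ.deriv]
  ring

variable {g : M5 → Matrix (Fin 5) (Fin 5) 𝕜} {G I : Fin 5 → Fin 5 → 𝕜}
  {S : Fin 5 → Fin 5 → Fin 5 → 𝕜}
  (hg : ∀ p a b, g p a b = G a b * (ρ a p * ρ b p))
  (hS : ∀ a b c p, (structConst a b c : 𝕜) * ρ c p = S a b c * (ρ a p * ρ b p))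

include hg hS

/-- Each term of Koszul's formula carries the same factor `ρ_a ρ_b ρ_c`: derivatives by the scaling
law, bracket terms because `hS` trades `ρ_d` for `ρ_a ρ_b`. The curvature identities below propagate
this homogeneity. -/
theorem christoffelLow_eq (a b c : Fin 5) (p : M5) :
    christoffelLow g a b c p = koszul G S δ w a b c * (ρ a p * ρ b p * ρ c p) := by
  have hsum : ∀ a b c, ∑ d, (structFun a b d p : 𝕜) * g p d c =
      (∑ d, S a b d * G d c) * (ρ a p * ρ b p * ρ c p) := fun a b c => by
    rw [Finset.sum_mul]
    refine Finset.sum_congr rfl fun d _ => ?_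
    rw [structFun_eq, hg]
    linear_combination (norm := (push_cast; ring)) G d c * ρ c p * hS a b d p
  simp only [christoffelLow, hsum]
  simp only [hg, hρ.frameDeriv_mul_mul, koszul]
  ring

variable (hI : ∀ a b, ∑ d, G a d * I d b = if a = b then 1 else 0)

include hI

omit hS in
theorem metric_mul_inv (p : M5) :
    g p * Matrix.of (fun a b => I a b * ((ρ a p)⁻¹ * (ρ b p)⁻¹)) = 1 := by
  ext a b
  rw [Matrix.mul_apply]
  have h1 : ∀ d, g p a d * Matrix.of (fun a b => I a b * ((ρ a p)⁻¹ * (ρ b p)⁻¹)) d b =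
      G a d * I d b * (ρ a p * (ρ b p)⁻¹) := fun d => by
    have := hρ.ne_zero d p
    rw [hg, Matrix.of_apply]
    field_simp
  rw [Finset.sum_congr rfl fun d _ => h1 d, ← Finset.sum_mul, hI, Matrix.one_apply]
  split_ifs with hab
  · rw [hab, one_mul, mul_inv_cancel₀ (hρ.ne_zero b p)]
  · rw [zero_mul]

omit hS in
theorem inv_metric_eq (p : M5) (a b : Fin 5) :
    (g p)⁻¹ a b = I a b * ((ρ a p)⁻¹ * (ρ b p)⁻¹) := by
  rw [Matrix.inv_eq_right_inv (hρ.metric_mul_inv hg hI p), Matrix.of_apply]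

theorem christoffel_eq (a b c : Fin 5) (p : M5) :
    christoffel g a b c p =
      raiseIndex (koszul G S δ w) I a b c * (ρ a p * ρ b p * (ρ c p)⁻¹) := by
  rw [christoffel, raiseIndex, Finset.sum_mul]
  refine Finset.sum_congr rfl fun d _ => ?_
  have := hρ.ne_zero d p
  have := hρ.ne_zero c p
  rw [hρ.christoffelLow_eq hg hS, hρ.inv_metric_eq hg hI]
  field_simp

theorem riemannUp_eq (a b c d : Fin 5) (p : M5) :
    riemannUp g a b c d p = curvature (raiseIndex (koszul G S δ w) I) S δ w a b c d *
      (ρ a p * ρ b p * ρ c p * (ρ d p)⁻¹) := by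
  have hΓ : ∀ a b c, christoffel g a b c = fun p =>
      raiseIndex (koszul G S δ w) I a b c * (ρ a p * ρ b p * (ρ c p)⁻¹) := fun a b c =>
    funext fun p => hρ.christoffel_eq hg hS hI a b c p
  simp only [riemannUp, curvature]
  rw [hΓ b c d, hΓ a c d, hρ.frameDeriv_mul_div, hρ.frameDeriv_mul_div, add_mul, Finset.sum_mul]
  congr 1
  · ring
  · refine Finset.sum_congr rfl fun e _ => ?_
    have he := hρ.ne_zero e p
    rw [structFun_eq]
    simp only [hΓ]
    have h1 := hS a b e p
    have h2 := mul_inv_cancel₀ he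
    set Γ := raiseIndex (koszul G S δ w) I
    push_cast
    linear_combination (Γ b c e * Γ a e d - Γ a c e * Γ b e d) *
      (ρ a p * ρ b p * ρ c p * (ρ d p)⁻¹) * h2 - Γ e c d * ρ c p * (ρ d p)⁻¹ * h1

theorem ricci_eq (b c : Fin 5) (p : M5) :
    ricci g b c p = (∑ a, curvature (raiseIndex (koszul G S δ w) I) S δ w a b c a) *
      (ρ b p * ρ c p) := by
  rw [ricci, Finset.sum_mul]
  refine Finset.sum_congr rfl fun a _ => ?_
  have := hρ.ne_zero a p
  rw [hρ.riemannUp_eq hg hS hI]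
  field_simp

theorem scalarCurv_eq (p : M5) :
    scalarCurv g p = ∑ b, ∑ c, I b c *
      ∑ a, curvature (raiseIndex (koszul G S δ w) I) S δ w a b c a := by
  refine Finset.sum_congr rfl fun b _ => Finset.sum_congr rfl fun c _ => ?_
  have := hρ.ne_zero b p
  have := hρ.ne_zero c p
  rw [hρ.ricci_eq hg hS hI, hρ.inv_metric_eq hg hI]
  field_simp

theorem riemannLow_eq (a b c d : Fin 5) (p : M5) :
    riemannLow g a b c d p =
      (∑ e, curvature (raiseIndex (koszul G S δ w) I) S δ w a b c e * G e d) *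
      (ρ a p * ρ b p * ρ c p * ρ d p) := by
  rw [riemannLow, Finset.sum_mul]
  refine Finset.sum_congr rfl fun e _ => ?_
  have := hρ.ne_zero e p
  rw [hρ.riemannUp_eq hg hS hI, hg]
  field_simp

/-- Since the `ρ` factors never vanish, flatness is decided by constants alone. -/
theorem weyl_eq (a b c d : Fin 5) (p : M5) :
    weyl g a b c d p = weylPart G (curvature (raiseIndex (koszul G S δ w) I) S δ w)
      (fun b c => ∑ a, curvature (raiseIndex (koszul G S δ w) I) S δ w a b c a)
      (∑ b, ∑ c, I b c * ∑ a, curvature (raiseIndex (koszul G S δ w) I) S δ w a b c a) a b c d *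
      (ρ a p * ρ b p * ρ c p * ρ d p) := by
  rw [weyl, hρ.riemannLow_eq hg hS hI, hρ.scalarCurv_eq hg hS hI]
  simp only [hρ.ricci_eq hg hS hI, hg, weylPart]
  ring

end IsScaling

end Scaling

/-! ### The two conformally flat cases, by exact arithmetic -/

section RatCast

variable {K : Type*} [Field K] [CharZero K]

/-- This and the next three lemmas move the tensor algebra from `𝕜` to `ℚ`, where equality is
decidable by evaluation. -/
theorem koszul_ratCast (G : Fin 5 → Fin 5 → ℚ) (S : Fin 5 → Fin 5 → Fin 5 → ℚ) (δ w : Fin 5 → ℚ) :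
    koszul (fun a b => (G a b : K)) (fun a b c => (S a b c : K)) (fun a => (δ a : K))
      (fun a => (w a : K)) = fun a b c => ((koszul G S δ w a b c : ℚ) : K) := by
  funext a b c
  simp only [koszul]
  push_cast
  rfl

theorem raiseIndex_ratCast (L : Fin 5 → Fin 5 → Fin 5 → ℚ) (I : Fin 5 → Fin 5 → ℚ) :
    raiseIndex (fun a b c => (L a b c : K)) (fun a b => (I a b : K)) =
      fun a b c => ((raiseIndex L I a b c : ℚ) : K) := by
  funext a b c
  simp only [raiseIndex]
  push_cast
  rfl

theorem curvature_ratCast (Γ S : Fin 5 → Fin 5 → Fin 5 → ℚ) (δ w : Fin 5 → ℚ) :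
    curvature (fun a b c => (Γ a b c : K)) (fun a b c => (S a b c : K)) (fun a => (δ a : K))
      (fun a => (w a : K)) = fun a b c d => ((curvature Γ S δ w a b c d : ℚ) : K) := by
  funext a b c d
  simp only [curvature]
  push_cast
  rfl

theorem weylPart_ratCast (G : Fin 5 → Fin 5 → ℚ) (R : Fin 5 → Fin 5 → Fin 5 → Fin 5 → ℚ)
    (Ric : Fin 5 → Fin 5 → ℚ) (s : ℚ) (a b c d : Fin 5) :
    weylPart (fun a b => (G a b : K)) (fun a b c d => (R a b c d : K)) (fun a b => (Ric a b : K))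
      (s : K) a b c d = ((weylPart G R Ric s a b c d : ℚ) : K) := by
  simp only [weylPart]
  push_cast
  rfl

end RatCast

/-- Vanishing of the Weyl tensor from a rational computation in a scaled frame. -/
theorem IsScaling.weyl_eq_zero {𝕜 : Type*} [RCLike 𝕜] {ρ : Fin 5 → M5 → 𝕜}
    {G I Ric : Fin 5 → Fin 5 → ℚ} {S Γ : Fin 5 → Fin 5 → Fin 5 → ℚ} {δ w : Fin 5 → ℚ} {s : ℚ}
    {g : M5 → Matrix (Fin 5) (Fin 5) 𝕜}
    (hρ : IsScaling ρ (fun a => (δ a : 𝕜)) (fun a => (w a : 𝕜)))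
    (hg : ∀ p a b, g p a b = G a b * (ρ a p * ρ b p))
    (hS : ∀ a b c p, (structConst a b c : 𝕜) * ρ c p = S a b c * (ρ a p * ρ b p))
    (hI : ∀ a b, ∑ d, G a d * I d b = if a = b then 1 else 0)
    (hΓ : ∀ a b c, raiseIndex (koszul G S δ w) I a b c = Γ a b c)
    (hRic : ∀ b c, ∑ a, curvature Γ S δ w a b c a = Ric b c)
    (hs : ∑ b, ∑ c, I b c * Ric b c = s)
    (hW : ∀ a b c d, weylPart G (curvature Γ S δ w) Ric s a b c d = 0)
    (a b c d : Fin 5) (p : M5) : weyl g a b c d p = 0 := by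
  have hI' : ∀ a b, ∑ d, (G a d : 𝕜) * (I d b : 𝕜) = if a = b then 1 else 0 := fun a b => by
    have := congrArg (fun x : ℚ => (x : 𝕜)) (hI a b)
    push_cast at this
    rw [this]
    split_ifs <;> simp
  have hΓ' : raiseIndex (koszul G S δ w) I = Γ := by
    funext a b c
    exact hΓ a b c
  rw [hρ.weyl_eq (G := fun a b => (G a b : 𝕜)) (I := fun a b => (I a b : 𝕜))
    (S := fun a b c => (S a b c : 𝕜)) hg hS hI' a b c d p]
  rw [koszul_ratCast, raiseIndex_ratCast, hΓ', curvature_ratCast]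
  have h1 : (fun b c => ∑ a, ((curvature Γ S δ w a b c a : ℚ) : 𝕜)) =
      fun b c => ((Ric b c : ℚ) : 𝕜) := by
    funext b c
    rw [← hRic]
    push_cast
    rfl
  have h2 : ∑ b, ∑ c, (I b c : 𝕜) * ∑ a, ((curvature Γ S δ w a b c a : ℚ) : 𝕜) = (s : 𝕜) := by
    rw [← hs]
    simp only [← hRic]
    push_cast
    rfl
  rw [h1, h2, weylPart_ratCast, hW, Rat.cast_zero, zero_mul]

/-- The structure constants in the frame scaled by `1, i, i, i, y` with `i² = -1`. -/
def structScaled (a b c : Fin 5) : ℚ :=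
  if (a, b, c) = (0, 1, 2) ∨ (a, b, c) = (2, 1, 0) ∨ (a, b, c) = (2, 0, 1) then -1
  else if (a, b, c) = (1, 0, 2) ∨ (a, b, c) = (1, 2, 0) ∨ (a, b, c) = (0, 2, 1) then 1 else 0

/-- The weights of the frame: only `∂/∂u` is rescaled by a nonconstant function. -/
def frameWeight : Fin 5 → ℚ := ![0, 0, 0, 0, 1]

/-- The logarithmic derivatives along the scaled frame. -/
def logDeriv (n : ℚ) : Fin 5 → ℚ := ![0, 0, 0, -n, 0]

/-- The case `t = 3i`, where `A = 1/2` and `B = -1/6`, in the frame divided by `1, i, i, i, y`. -/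
def metricThree : Fin 5 → Fin 5 → ℚ :=
  ![![1/2, 0, 0, 0, -1/2],
   ![0, -1/2, 0, 1/2, 0],
   ![0, 0, 1/6, 0, -1/2],
   ![0, 1/2, 0, 3/2, 0],
   ![-1/2, 0, -1/2, 0, 0]]

def metricInvThree : Fin 5 → Fin 5 → ℚ :=
  ![![3/2, 0, -3/2, 0, -1/2],
   ![0, -3/2, 0, 1/2, 0],
   ![-3/2, 0, 3/2, 0, -3/2],
   ![0, 1/2, 0, 1/2, 0],
   ![-1/2, 0, -3/2, 0, -1/2]]

/-- Tabulating connection and Ricci tensor lets each kernel check evaluate a single layer of the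
curvature computation. -/
def connectionThree : Fin 5 → Fin 5 → Fin 5 → ℚ :=
  ![![![0, 0, 0, 0, 0],
     ![0, 0, -1/2, 0, 0],
     ![0, 0, 0, 1/6, 0],
     ![0, 0, -3/2, 0, 0],
     ![0, 0, 0, -1/2, 0]],
   ![![0, 0, 1/2, 0, 0],
     ![0, 0, 0, 0, 0],
     ![0, 0, 1/2, 0, 1/6],
     ![0, 0, 0, 0, 0],
     ![0, 0, 0, 0, -1/2]],
   ![![0, -1, 0, 1/6, 0],
     ![-1, 0, 1/2, 0, 1/6],
     ![0, 0, 0, 0, 0],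
     ![0, 0, -3/2, 0, -1/2],
     ![0, 0, 0, -1/2, 0]],
   ![![0, 0, -3/2, 0, 0],
     ![0, 0, 0, 0, 0],
     ![0, 0, -3/2, 0, -1/2],
     ![0, 0, 0, 0, 0],
     ![0, 0, 0, 0, -3/2]],
   ![![0, 0, 0, -1/2, 0],
     ![0, 0, 0, 0, -1/2],
     ![0, 0, 0, -1/2, 0],
     ![0, 0, 0, 0, -3/2],
     ![0, 0, 0, 0, 0]]]

def ricciThree : Fin 5 → Fin 5 → ℚ :=
  ![![3/2, 0, 0, 0, 3/2],
   ![0, -3/2, 0, -3/2, 0],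
   ![0, 0, -1/2, 0, 3/2],
   ![0, -3/2, 0, -9/2, 0],
   ![3/2, 0, 3/2, 0, 0]]

/-- The case `t = i/3`, where `A = B = 3/2`, in the same scaled frame. -/
def metricThird : Fin 5 → Fin 5 → ℚ :=
  ![![3/2, 0, 0, 0, 1/2],
   ![0, -3/2, 0, -1/2, 0],
   ![0, 0, -3/2, 0, 1/2],
   ![0, -1/2, 0, 1/2, 0],
   ![1/2, 0, 1/2, 0, -2/3]]

def metricInvThird : Fin 5 → Fin 5 → ℚ :=
  ![![1/2, 0, 1/6, 0, 1/2],
   ![0, -1/2, 0, -1/2, 0],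
   ![1/6, 0, -5/6, 0, -1/2],
   ![0, -1/2, 0, 3/2, 0],
   ![1/2, 0, -1/2, 0, -3/2]]

def connectionThird : Fin 5 → Fin 5 → Fin 5 → ℚ :=
  ![![![0, 0, 0, 0, 0],
     ![0, 0, -1/2, 0, 0],
     ![0, 1/2, 0, 0, 0],
     ![0, 0, -1/6, 0, 0],
     ![0, -1/6, 0, 0, 0]],
   ![![0, 0, 1/2, 0, 0],
     ![0, 0, 0, 0, 0],
     ![1/2, 0, 0, 0, 0],
     ![0, 0, 0, 0, 0],
     ![-1/6, 0, 1/6, 0, 0]],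
   ![![0, -1/2, 0, 0, 0],
     ![-1/2, 0, 0, 0, 0],
     ![0, 0, 0, 0, 0],
     ![-1/6, 0, 0, 0, 0],
     ![0, -1/6, 0, 0, 0]],
   ![![0, 0, -1/6, 0, 0],
     ![0, 0, 0, 0, 0],
     ![-1/6, 0, 0, 0, 0],
     ![0, 0, 0, 0, 0],
     ![1/18, 0, -1/18, 0, -1/3]],
   ![![0, -1/6, 0, 0, 0],
     ![-1/6, 0, 1/6, 0, 0],
     ![0, -1/6, 0, 0, 0],
     ![1/18, 0, -1/18, 0, -1/3],
     ![0, 1/9, 0, -1/3, 0]]]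

def ricciThird : Fin 5 → Fin 5 → ℚ :=
  ![![1/2, 0, 0, 0, 1/6],
   ![0, -1/2, 0, -1/6, 0],
   ![0, 0, -1/2, 0, 1/6],
   ![0, -1/6, 0, -1/6, 0],
   ![1/6, 0, 1/6, 0, 1/9]]

theorem metricThree_inv (a b : Fin 5) :
    ∑ d, metricThree a d * metricInvThree d b = if a = b then 1 else 0 := by
  revert a b
  decide +kernel

theorem connectionThree_eq (a b c : Fin 5) :
    raiseIndex (koszul metricThree structScaled (logDeriv 3) frameWeight) metricInvThree a b c =
      connectionThree a b c := by
  revert a b c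
  decide +kernel

theorem ricciThree_eq (b c : Fin 5) :
    ∑ a, curvature connectionThree structScaled (logDeriv 3) frameWeight a b c a =
      ricciThree b c := by
  revert b c
  decide +kernel

theorem scalarThree_eq : ∑ b, ∑ c, metricInvThree b c * ricciThree b c = (-6) := by
  decide +kernel

theorem weylThree_eq (a b c d : Fin 5) :
    weylPart metricThree (curvature connectionThree structScaled (logDeriv 3) frameWeight)
      ricciThree (-6) a b c d = 0 := by
  revert a b c d
  decide +kernel

theorem metricThird_inv (a b : Fin 5) :
    ∑ d, metricThird a d * metricInvThird d b = if a = b then 1 else 0 := by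
  revert a b
  decide +kernel

theorem connectionThird_eq (a b c : Fin 5) :
    raiseIndex (koszul metricThird structScaled (logDeriv (1 / 3)) frameWeight) metricInvThird a b c =
      connectionThird a b c := by
  revert a b c
  decide +kernel

theorem ricciThird_eq (b c : Fin 5) :
    ∑ a, curvature connectionThird structScaled (logDeriv (1 / 3)) frameWeight a b c a =
      ricciThird b c := by
  revert b c
  decide +kernel

theorem scalarThird_eq : ∑ b, ∑ c, metricInvThird b c * ricciThird b c = (2 / 3) := by
  decide +kernel

theorem weylThird_eq (a b c d : Fin 5) :
    weylPart metricThird (curvature connectionThird structScaled (logDeriv (1 / 3)) frameWeight)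
      ricciThird (2 / 3) a b c d = 0 := by
  revert a b c d
  decide +kernel

variable {𝕜 : Type*} [RCLike 𝕜]

/-! ### The warping function -/

theorem hasDerivAt_warp (a c k : 𝕜) (r : ℝ) :
    HasDerivAt (warp a c k) (-(c / a) * warp a c k r) r := by
  have h1 : HasDerivAt (fun z : 𝕜 => NormedSpace.exp z) (NormedSpace.exp (-(c / a) * (r : 𝕜)))
      (-(c / a) * (r : 𝕜)) := hasDerivAt_exp
  have h2 : HasDerivAt (fun x : ℝ => -(c / a) * (x : 𝕜)) (-(c / a)) r := by
    have h3 : HasDerivAt (fun x : ℝ => (x : 𝕜)) 1 r := by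
      simpa using (RCLike.ofRealCLM (K := 𝕜)).hasDerivAt (x := r)
    simpa using h3.const_mul (-(c / a))
  exact ((h1.comp r h2).const_mul k).congr_deriv (by rw [warp]; ring)

theorem warp_ne_zero {a c k : 𝕜} (hk : k ≠ 0) (r : ℝ) : warp a c k r ≠ 0 := by
  refine mul_ne_zero hk ?_
  have h := NormedSpace.exp_add_of_commute (Commute.neg_left (Commute.refl (-(c / a) * (r : 𝕜))))
  intro h0
  rw [neg_add_cancel, NormedSpace.exp_zero, h0, mul_zero] at h
  exact one_ne_zero h

theorem contDiff_warp (a c k : 𝕜) {n : ℕ∞ω} : ContDiff ℝ n (warp a c k) := by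
  have h1 : ContDiff ℝ n (fun z : 𝕜 => NormedSpace.exp z) :=
    AnalyticOnNhd.contDiff fun x _ => NormedSpace.exp_analytic x
  have h2 : ContDiff ℝ n (fun x : ℝ => -(c / a) * (x : 𝕜)) :=
    contDiff_const.mul (RCLike.ofRealCLM (K := 𝕜)).contDiff
  exact contDiff_const.mul (h1.comp h2)

/-- The coefficient `a f / s`. -/
def warpCoeff (a c k s : 𝕜) (p : M5) : 𝕜 := a / s * warp a c k p.2.1

theorem contMDiff_warp (a c k : 𝕜) {n : ℕ∞ω} :
    ContMDiff IM 𝓘(ℝ, 𝕜) n (fun p : M5 => warp a c k p.2.1) := by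
  have h : ContDiff ℝ n (fun x : ℝ × ℝ => warp a c k x.1) := (contDiff_warp a c k).comp contDiff_fst
  exact h.contMDiff.comp contMDiff_snd

theorem contMDiff_const_mul {h : M5 → 𝕜} {n : ℕ∞ω} (hh : ContMDiff IM 𝓘(ℝ, 𝕜) n h) (b : 𝕜) :
    ContMDiff IM 𝓘(ℝ, 𝕜) n (fun p => b * h p) := by
  have h1 : ContDiff ℝ n (fun z : 𝕜 => b * z) := contDiff_const.mul contDiff_id
  exact h1.contMDiff.comp hh

theorem contMDiff_warpCoeff (a c k s : 𝕜) {n : ℕ∞ω} :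
    ContMDiff IM 𝓘(ℝ, 𝕜) n (warpCoeff a c k s) := contMDiff_const_mul (contMDiff_warp a c k) _

theorem frameDeriv_warpCoeff (a c k s : 𝕜) (e : Fin 5) (p : M5) :
    frameDeriv e (warpCoeff a c k s) p =
      if e = 3 then -(c / a) * warpCoeff a c k s p else 0 := by
  have h := frameDeriv_radial e (p := p) ((hasDerivAt_warp a c k p.2.1).const_mul (a / s))
  refine h.trans ?_
  simp only [warpCoeff]
  split_ifs <;> ring

theorem warpCoeff_ne_zero {a c k s : 𝕜} (ha : a ≠ 0) (hk : k ≠ 0) (hs : s ≠ 0) (p : M5) :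
    warpCoeff a c k s p ≠ 0 :=
  mul_ne_zero (div_ne_zero ha hs) (warp_ne_zero hk _)

/-! ### The Weyl tensor of the metric `gm` -/

/-- The coefficient of `ω₁ω₁ + ω₂ω₂`. -/
def coeffA (a c : 𝕜) : 𝕜 := 1 / 5 * (a ^ 2 / (a ^ 2 + c ^ 2)) * ((7 * a ^ 2 + 3 * c ^ 2) / a ^ 2)

/-- The coefficient of `ω₃ω₃`. -/
def coeffB (a c : 𝕜) : 𝕜 := 4 / 3 * (a ^ 2 / (a ^ 2 + c ^ 2))

theorem omega_eq {a c k s : 𝕜} (ha : a ≠ 0) (i : Fin 5) (p : M5) :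
    omega a c s (warp a c k) i p =
      (![![1, 0, 0, 0, warpCoeff a c k s p], ![0, 1, 0, 1, 0],
        ![0, 0, 1, 0, c / a * warpCoeff a c k s p], ![0, 0, 0, 1, 0],
        ![0, 0, 0, 0, -warpCoeff a c k s p]] : Fin 5 → Fin 5 → 𝕜) i := by
  have h1 : ∀ b : 𝕜, b * warp a c k p.2.1 / s = b / a * warpCoeff a c k s p := fun b => by
    rw [warpCoeff]
    field_simp
  have h2 : a / s * warp a c k p.2.1 = warpCoeff a c k s p := rfl
  funext j
  simp only [omega, h1, h2, div_self ha, one_mul]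
  fin_cases i <;> fin_cases j <;> simp [dualForm]

theorem gm_eq {a c k s : 𝕜} (ha : a ≠ 0) (p : M5) :
    gm a c s (warp a c k) p =
      !![coeffA a c, 0, 0, 0, (coeffA a c - 1) * warpCoeff a c k s p;
        0, coeffA a c, 0, coeffA a c - 1, 0;
        0, 0, coeffB a c, 0, coeffB a c * (c / a) * warpCoeff a c k s p;
        0, coeffA a c - 1, 0, coeffA a c - 2, 0;
        (coeffA a c - 1) * warpCoeff a c k s p, 0, coeffB a c * (c / a) * warpCoeff a c k s p, 0,
          (coeffA a c - 2 + coeffB a c * (c / a) ^ 2) * warpCoeff a c k s p ^ 2] := by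
  have h : gm a c s (warp a c k) p =
      (2 : 𝕜) • symProd (omega a c s (warp a c k) 0 p) (omega a c s (warp a c k) 4 p)
      - (2 : 𝕜) • symProd (omega a c s (warp a c k) 1 p) (omega a c s (warp a c k) 3 p)
      + coeffB a c • symProd (omega a c s (warp a c k) 2 p) (omega a c s (warp a c k) 2 p)
      + coeffA a c • (symProd (omega a c s (warp a c k) 0 p) (omega a c s (warp a c k) 0 p)
        + symProd (omega a c s (warp a c k) 1 p) (omega a c s (warp a c k) 1 p)) := by
    rw [gm, coeffA, coeffB]
  rw [h]
  simp only [omega_eq ha]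
  clear h
  generalize coeffA a c = A
  generalize coeffB a c = B
  generalize warpCoeff a c k s p = y
  ext i j
  simp only [Matrix.add_apply, Matrix.sub_apply, Matrix.smul_apply, symProd, Matrix.of_apply]
  fin_cases i <;> fin_cases j <;> simp <;> ring

/-- The scaling functions `1, i, i, i, a f / s` of the frame. -/
def frameScale (a c k s i : 𝕜) : Fin 5 → M5 → 𝕜 :=
  ![fun _ => 1, fun _ => i, fun _ => i, fun _ => i, warpCoeff a c k s]

theorem isScaling_frameScale {a c k s i : 𝕜} (ha : a ≠ 0) (hk : k ≠ 0) (hs : s ≠ 0) (hi : i ≠ 0)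
    {δ w : Fin 5 → 𝕜} (hδ : δ = ![0, 0, 0, -(c / a / i), 0]) (hw : w = ![0, 0, 0, 0, 1]) :
    IsScaling (frameScale a c k s i) δ w where
  ne_zero e p := by
    fin_cases e
    · exact one_ne_zero
    · exact hi
    · exact hi
    · exact hi
    · exact warpCoeff_ne_zero ha hk hs p
  mdifferentiableAt e p := by
    fin_cases e
    · exact mdifferentiableAt_const
    · exact mdifferentiableAt_const
    · exact mdifferentiableAt_const
    · exact mdifferentiableAt_const
    · exact (contMDiff_warpCoeff a c k s (n := 1) p).mdifferentiableAt one_ne_zero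
  deriv e b p := by
    subst hδ hw
    fin_cases b
    · exact (frameDeriv_const e 1 p).trans (by simp)
    · exact (frameDeriv_const e i p).trans (by simp)
    · exact (frameDeriv_const e i p).trans (by simp)
    · exact (frameDeriv_const e i p).trans (by simp)
    · refine (frameDeriv_warpCoeff a c k s e p).trans ?_
      fin_cases e <;> simp [frameScale, hi]

theorem structConst_eq_structScaled {a c k s i : 𝕜} (hi : i ^ 2 = -1) (e b d : Fin 5) (p : M5) :
    (structConst e b d : 𝕜) * frameScale a c k s i d p =
      structScaled e b d * (frameScale a c k s i e p * frameScale a c k s i b p) := by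
  fin_cases e <;> fin_cases b <;> fin_cases d <;>
    simp [structConst, structScaled, frameScale, ← pow_two, hi]

/-- Here `i` is any square root of `-1` in `𝕜`; for real scalars none exists and the statement is
vacuous. Since `t / i` and `t²` are rational, so are all coefficients in the scaled frame. -/
theorem weyl_gm_eq_zero {a c k s i : 𝕜} (ha : a ≠ 0) (hk : k ≠ 0) (hs : s ≠ 0) (hi : i ^ 2 = -1)
    (h : c / a = 3 * i ∨ c / a = 1 / 3 * i) (e b d f : Fin 5) (p : M5) :
    weyl (gm a c s (warp a c k)) e b d f p = 0 := by
  have hi0 : i ≠ 0 := by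
    rintro rfl
    norm_num at hi
  have hw : (fun e => (frameWeight e : 𝕜)) = ![0, 0, 0, 0, 1] := by
    funext e
    fin_cases e <;> simp [frameWeight]
  have hδ : ∀ n : ℚ, c / a = n * i →
      (fun e => (logDeriv n e : 𝕜)) = ![0, 0, 0, -(c / a / i), 0] := fun n hn => by
    funext e
    fin_cases e <;> simp [logDeriv, hn, hi0]
  have hA : coeffA a c = (7 + 3 * (c / a) ^ 2) / (5 * (1 + (c / a) ^ 2)) := by
    rw [coeffA]
    field_simp
  have hB : coeffB a c = 4 / (3 * (1 + (c / a) ^ 2)) := by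
    rw [coeffB]
    field_simp
  rcases h with h | h
  · rw [h, mul_pow, hi] at hA hB
    norm_num at hA hB
    refine (isScaling_frameScale (c := c) ha hk hs hi0 (hδ 3 (by push_cast; exact h)) hw).weyl_eq_zero
      (fun q x y => ?_) (structConst_eq_structScaled hi)
      metricThree_inv connectionThree_eq ricciThree_eq scalarThree_eq weylThree_eq e b d f p
    rw [gm_eq ha, h, hA, hB]
    clear hA hB
    fin_cases x <;> fin_cases y <;>
      simp [metricThree, frameScale, -mul_eq_mul_right_iff, -mul_eq_mul_left_iff, -mul_eq_zero]
    all_goals try ring1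
    · linear_combination (1 / 2) * hi
    · linear_combination (-1 / 2) * hi
    · linear_combination (-1 / 6) * hi
    · linear_combination (-1 / 2) * hi
    · linear_combination (-3 / 2) * hi
    · linear_combination (-3 / 2) * warpCoeff a c k s q ^ 2 * hi
  · rw [h, mul_pow, hi] at hA hB
    norm_num at hA hB
    refine (isScaling_frameScale (c := c) ha hk hs hi0 (hδ (1 / 3) (by push_cast; exact h)) hw).weyl_eq_zero
      (fun q x y => ?_) (structConst_eq_structScaled hi)
      metricThird_inv connectionThird_eq ricciThird_eq scalarThird_eq weylThird_eq e b d f p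
    rw [gm_eq ha, h, hA, hB]
    clear hA hB
    fin_cases x <;> fin_cases y <;>
      simp [metricThird, frameScale, -mul_eq_mul_right_iff, -mul_eq_mul_left_iff, -mul_eq_zero]
    all_goals try ring1
    · linear_combination (3 / 2) * hi
    · linear_combination (1 / 2) * hi
    · linear_combination (3 / 2) * hi
    · linear_combination (1 / 2) * hi
    · linear_combination (-1 / 2) * hi
    · linear_combination (1 / 6) * warpCoeff a c k s q ^ 2 * hi

/-- The inverse of the metric coefficients. -/
def metricInv (A B t : 𝕜) : Fin 5 → Fin 5 → 𝕜 :=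
  ![![2 - A, 0, t * (1 - A), 0, A - 1],
    ![0, 2 - A, 0, A - 1, 0],
    ![t * (1 - A), 0, B⁻¹ - A * t ^ 2, 0, t * A],
    ![0, A - 1, 0, -A, 0],
    ![A - 1, 0, t * A, 0, -A]]

/-- The metric coefficients of `gm` in the scaled frame. -/
def metricCoeff (A B t : 𝕜) : Fin 5 → Fin 5 → 𝕜 :=
  ![![A, 0, 0, 0, A - 1],
    ![0, A, 0, A - 1, 0],
    ![0, 0, B, 0, B * t],
    ![0, A - 1, 0, A - 2, 0],
    ![A - 1, 0, B * t, 0, A - 2 + B * t ^ 2]]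

theorem metricCoeff_inv {A B : 𝕜} (hB : B ≠ 0) (t : 𝕜) (x y : Fin 5) :
    ∑ d, metricCoeff A B t x d * metricInv A B t d y = if x = y then 1 else 0 := by
  rw [Fin.sum_univ_five]
  fin_cases x <;> fin_cases y <;> simp [metricCoeff, metricInv] <;> field_simp <;> ring

theorem gm_eq_metricCoeff {a c k s : 𝕜} (ha : a ≠ 0) (p : M5) (x y : Fin 5) :
    gm a c s (warp a c k) p x y = metricCoeff (coeffA a c) (coeffB a c) (c / a) x y *
      (frameScale a c k s 1 x p * frameScale a c k s 1 y p) := by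
  rw [gm_eq ha]
  fin_cases x <;> fin_cases y <;> simp [metricCoeff, frameScale, -mul_eq_mul_right_iff, -mul_eq_mul_left_iff]
  all_goals ring

/-- The metric does not mix the index blocks `{0, 2, 4}` and `{1, 3}`, so all Ricci and scalar
corrections vanish for the indices `0, 4, 1, 3`. That is why `Ric` and `s` are arbitrary: the
component is purely a Riemann one. -/
theorem weylPart_metricCoeff {A B : 𝕜} (hB : B ≠ 0) (t : 𝕜)
    (Ric : Fin 5 → Fin 5 → 𝕜) (s : 𝕜) :
    weylPart (metricCoeff A B t)
      (curvature (raiseIndex (koszul (metricCoeff A B t) (fun e b d => (structConst e b d : 𝕜))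
        ![0, 0, 0, -t, 0] ![0, 0, 0, 0, 1]) (metricInv A B t))
        (fun e b d => (structConst e b d : 𝕜)) ![0, 0, 0, -t, 0] ![0, 0, 0, 0, 1])
      Ric s 0 4 1 3 = ((A - 1) ^ 2 / B + B * t ^ 2) / 4 := by
  set L := koszul (metricCoeff A B t) (fun e b d => (structConst e b d : 𝕜))
    ![0, 0, 0, -t, 0] ![0, 0, 0, 0, 1] with hL
  -- The derivative terms drop out (only `∂_r` differentiates `y`) and so does the bracket of `e_0`
  -- and `e_4`. The rows computed here are the only ones entering the remaining quadratic terms in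
  -- the connection.
  have hL41 : L 4 1 = ![-(B * t / 2), 0, (A - 1) / 2, 0, 0] := by
    funext d
    fin_cases d <;> simp [hL, koszul, metricCoeff, structConst]
    all_goals ring
  have hL01 : L 0 1 = ![0, 0, -(B / 2), 0, -(B * t / 2)] := by
    funext d
    fin_cases d <;> simp [hL, koszul, metricCoeff, structConst] <;> ring
  have hL00 : L 0 0 = 0 := by
    funext d
    fin_cases d <;> simp [hL, koszul, metricCoeff, structConst]
  have hL02 : L 0 2 = ![0, B / 2, 0, (A - 1) / 2, 0] := by
    funext d
    fin_cases d <;> simp [hL, koszul, metricCoeff, structConst]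
  have hL04 : L 0 4 = ![0, B * t / 2, 0, t * (A - 1) / 2, 0] := by
    funext d
    fin_cases d <;> simp [hL, koszul, metricCoeff, structConst]
  have hL42 : L 4 2 = ![0, -((A - 1) / 2), 0, B * t ^ 2 / 2, 0] := by
    funext d
    fin_cases d <;> simp [hL, koszul, metricCoeff, structConst] <;> ring
  clear_value L
  set Γ := raiseIndex L (metricInv A B t) with hΓ
  have hBB : B * B⁻¹ = 1 := mul_inv_cancel₀ hB
  have h41 : ∀ d, Γ 4 1 d = ![-(B * (2 - A) + (A - 1) ^ 2) * t / 2, 0,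
      (A - 1) * (B * t ^ 2 + B⁻¹ - A * t ^ 2) / 2, 0, (A - 1) * t * (A - B) / 2] d := fun d => by
    fin_cases d <;> simp [hΓ, raiseIndex, Fin.sum_univ_five, hL41, metricInv] <;> ring
  have h01 : ∀ d, Γ 0 1 d = ![0, 0, -(1 / 2), 0, 0] d := fun d => by
    fin_cases d <;> simp [hΓ, raiseIndex, Fin.sum_univ_five, hL01, metricInv]
    all_goals try ring1
    linear_combination (-1 / 2) * hBB
  have h00 : ∀ d, Γ 0 0 d = 0 := fun d => by
    simp [hΓ, raiseIndex, hL00]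
  have h02 : ∀ d, Γ 0 2 d =
      B / 2 * metricInv A B t 1 d + (A - 1) / 2 * metricInv A B t 3 d := fun d => by
    simp [hΓ, raiseIndex, Fin.sum_univ_five, hL02]
  have h04 : ∀ d, Γ 0 4 d =
      B * t / 2 * metricInv A B t 1 d + t * (A - 1) / 2 * metricInv A B t 3 d := fun d => by
    simp [hΓ, raiseIndex, Fin.sum_univ_five, hL04]
  have h42 : ∀ d, Γ 4 2 d =
      -((A - 1) / 2) * metricInv A B t 1 d + B * t ^ 2 / 2 * metricInv A B t 3 d := fun d => by
    simp [hΓ, raiseIndex, Fin.sum_univ_five, hL42]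
  clear_value Γ
  simp [weylPart, curvature, Fin.sum_univ_five, h41, h01, h00, h02, h04, h42, metricCoeff,
    metricInv, structConst]
  field_simp
  ring

/-- After substituting `A` and `B`, the numerator is `9 (1 - t²)² + 100 t² = (9 + t²)(1 + 9 t²)`.
The scaling here uses `1` in place of `i`, so it makes sense for every `𝕜`. -/
theorem weyl_gm_eq {a c k s : 𝕜} (ha : a ≠ 0) (hk : k ≠ 0) (hac : a ^ 2 + c ^ 2 ≠ 0) (hs : s ≠ 0)
    (p : M5) : weyl (gm a c s (warp a c k)) 0 4 1 3 p =
      (9 * a ^ 2 + c ^ 2) * (a ^ 2 + 9 * c ^ 2) / (300 * a ^ 2 * (a ^ 2 + c ^ 2)) *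
        warpCoeff a c k s p := by
  have hB : coeffB a c ≠ 0 := by
    rw [coeffB]
    exact mul_ne_zero (by norm_num) (div_ne_zero (pow_ne_zero 2 ha) hac)
  have hS : ∀ (e b d : Fin 5) (p : M5), (structConst e b d : 𝕜) * frameScale a c k s 1 d p =
      (structConst e b d : 𝕜) * (frameScale a c k s 1 e p * frameScale a c k s 1 b p) := by
    intro e b d p
    fin_cases e <;> fin_cases b <;> fin_cases d <;> simp [structConst, frameScale]
  rw [(isScaling_frameScale (c := c) ha hk hs one_ne_zero rfl rfl).weyl_eq (gm_eq_metricCoeff ha)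
    (S := fun e b d => (structConst e b d : 𝕜)) hS (metricCoeff_inv hB _)]
  have h1 : frameScale a c k s 1 0 p * frameScale a c k s 1 4 p * frameScale a c k s 1 1 p *
      frameScale a c k s 1 3 p = warpCoeff a c k s p := by
    simp [frameScale]
  rw [h1]
  congr 1
  rw [show (-(c / a / 1)) = -(c / a) by rw [div_one], weylPart_metricCoeff hB]
  rw [coeffA, coeffB]
  field_simp
  ring

/-! ### The null fields -/

theorem isNullField_X1 (f : ℝ → 𝕜) : IsNullField (productMetric f) X1 := fun p => by
  refine ⟨fun h => ?_, ?_⟩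
  · simpa [X1] using congrFun h 1
  · simp [X1, productMetric, symProd, dualForm, Matrix.mulVec, dotProduct, Fin.sum_univ_five]

theorem isNullField_X2 {a c s : 𝕜} {f : ℝ → 𝕜} (ha : a ≠ 0) (hs : s ^ 2 = a ^ 2 + c ^ 2)
    (hf : ∀ r, f r ≠ 0) : IsNullField (productMetric f) (X2 a c s f) := fun p => by
  refine ⟨fun h => ha (by simpa [X2] using congrFun h 0), ?_⟩
  have := hf p.2.1
  simp [X2, productMetric, symProd, dualForm, Matrix.mulVec, dotProduct, Fin.sum_univ_five]
  field_simp
  linear_combination -hs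

/-! ### The distribution -/

theorem X2_eq {a c k s : 𝕜} (ha : a ≠ 0) (hs : s ≠ 0) (hk : k ≠ 0) (p : M5) :
    X2 a c s (warp a c k) p = ![a, 0, c, 0, -(a / warpCoeff a c k s p)] := by
  have := warp_ne_zero (a := a) (c := c) hk p.2.1
  rw [X2, warpCoeff]
  congr 5
  field_simp

theorem contMDiff_inv_warpCoeff {a c k s : 𝕜} (ha : a ≠ 0) (hs : s ≠ 0) (hk : k ≠ 0) {n : ℕ∞ω} :
    ContMDiff IM 𝓘(ℝ, 𝕜) n (fun p => (warpCoeff a c k s p)⁻¹) := fun p => by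
  have h : ContDiffAt ℝ n (fun z : 𝕜 => z⁻¹) (warpCoeff a c k s p) :=
    contDiffAt_inv ℝ (warpCoeff_ne_zero ha hk hs p)
  exact h.contMDiffAt.comp p (contMDiff_warpCoeff a c k s p)

section Distribution

variable {a c k s : 𝕜}

/-- The three equations are the vanishing of `ω₁, ω₂, ω₃`. Conversely, the `E²` and `E¹` components
of a vector dictate its coefficients along `X1` and `X2`. -/
theorem mem_spanDist_iff (ha : a ≠ 0) (hs : s ≠ 0) (hk : k ≠ 0) (p : M5) (v : Fin 5 → 𝕜) :
    v ∈ spanDist X1 (X2 a c s (warp a c k)) p ↔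
      v 0 + warpCoeff a c k s p * v 4 = 0 ∧ v 1 + v 3 = 0 ∧
        v 2 + c / a * warpCoeff a c k s p * v 4 = 0 := by
  have hy := warpCoeff_ne_zero (c := c) ha hk hs p
  rw [spanDist, Submodule.mem_span_pair, X2_eq ha hs hk]
  constructor
  · rintro ⟨x, y, rfl⟩
    simp [X1]
    refine ⟨?_, ?_⟩ <;> field_simp <;> ring
  · rintro ⟨h0, h1, h2⟩
    refine ⟨v 1, v 0 / a, ?_⟩
    funext i
    fin_cases i <;> simp [X1]
    · field_simp
    · field_simp
      field_simp at h2
      linear_combination c * h0 - h2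
    · linear_combination -h1
    · field_simp
      linear_combination -h0

/-- The derived distribution `[D, D]`, as a kernel. -/
def derivedDist (y : M5 → 𝕜) (p : M5) : Submodule 𝕜 (Fin 5 → 𝕜) where
  carrier := {v | v 0 + y p * v 4 = 0 ∧ v 1 + v 3 = 0}
  zero_mem' := by simp
  add_mem' {v w} hv hw := by
    constructor
    · simp only [Pi.add_apply]
      linear_combination hv.1 + hw.1
    · simp only [Pi.add_apply]
      linear_combination hv.2 + hw.2
  smul_mem' x v hv := by
    constructor
    · simp only [Pi.smul_apply, smul_eq_mul]
      linear_combination x * hv.1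
    · simp only [Pi.smul_apply, smul_eq_mul]
      linear_combination x * hv.2

theorem mem_derivedDist_iff (y : M5 → 𝕜) (p : M5) (v : Fin 5 → 𝕜) :
    v ∈ derivedDist y p ↔ v 0 + y p * v 4 = 0 ∧ v 1 + v 3 = 0 := Iff.rfl

theorem SmoothOn.mdifferentiableAt {X : M5 → Fin 5 → 𝕜} (hX : SmoothOn Set.univ X) (e : Fin 5)
    (p : M5) : MDifferentiableAt IM 𝓘(ℝ, 𝕜) (fun q => X q e) p :=
  ((contMDiffOn_univ.1 (hX e)) p).mdifferentiableAt (by simp)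

/-- The Lie bracket with the structure constants of the frame inserted. -/
theorem lieBr_eq (X Y : M5 → Fin 5 → 𝕜) (p : M5) (e : Fin 5) :
    lieBr X Y p e =
      ∑ b, (X p b * frameDeriv b (fun q => Y q e) p - Y p b * frameDeriv b (fun q => X q e) p) +
        ![X p 2 * Y p 1 - X p 1 * Y p 2, X p 0 * Y p 2 - X p 2 * Y p 0,
          X p 1 * Y p 0 - X p 0 * Y p 1, 0, 0] e := by
  rw [lieBr]
  congr 1
  simp only [structFun_eq]
  fin_cases e <;> simp [Fin.sum_univ_five, structConst] <;> ring

theorem frameDeriv_of_mem_spanDist (ha : a ≠ 0) (hs : s ≠ 0) (hk : k ≠ 0)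
    {X : M5 → Fin 5 → 𝕜} (hX : SmoothOn Set.univ X)
    (hD : ∀ q, X q ∈ spanDist X1 (X2 a c s (warp a c k)) q) (e : Fin 5) (p : M5) :
    frameDeriv e (fun q => X q 0) p = -(warpCoeff a c k s p * frameDeriv e (fun q => X q 4) p +
        X p 4 * if e = 3 then -(c / a) * warpCoeff a c k s p else 0) ∧
      frameDeriv e (fun q => X q 1) p = -frameDeriv e (fun q => X q 3) p := by
  have hy : MDifferentiableAt IM 𝓘(ℝ, 𝕜) (warpCoeff a c k s) p :=
    (contMDiff_warpCoeff a c k s (n := 1) p).mdifferentiableAt one_ne_zero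
  have hm : MDifferentiableAt IM 𝓘(ℝ, 𝕜) (fun q => warpCoeff a c k s q * X q 4) p :=
    hy.mul (hX.mdifferentiableAt 4 p)
  have hD' := fun q => (mem_spanDist_iff ha hs hk q (X q)).1 (hD q)
  constructor
  · have h1 := frameDeriv_add e (hX.mdifferentiableAt 0 p) hm
    rw [funext fun q => (hD' q).1, frameDeriv_const,
      frameDeriv_mul e hy (hX.mdifferentiableAt 4 p), frameDeriv_warpCoeff] at h1
    linear_combination -h1
  · have h1 := frameDeriv_add e (hX.mdifferentiableAt 1 p) (hX.mdifferentiableAt 3 p)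
    rw [funext fun q => (hD' q).2.1, frameDeriv_const] at h1
    linear_combination -h1

/-- In terms of forms, `dω₁` and `dω₂` vanish on pairs of vectors in `D`. For `ω₁` the derivative of
`y` along `∂_r` cancels the contribution of `σ₂ ∧ σ₃`. -/
theorem lieBr_mem_derivedDist (ha : a ≠ 0) (hs : s ≠ 0) (hk : k ≠ 0)
    {X Y : M5 → Fin 5 → 𝕜} (hX : SmoothOn Set.univ X) (hY : SmoothOn Set.univ Y)
    (hXD : ∀ q, X q ∈ spanDist X1 (X2 a c s (warp a c k)) q)
    (hYD : ∀ q, Y q ∈ spanDist X1 (X2 a c s (warp a c k)) q) (p : M5) :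
    lieBr X Y p ∈ derivedDist (warpCoeff a c k s) p := by
  obtain ⟨hX0, hX1, hX2⟩ := (mem_spanDist_iff ha hs hk p (X p)).1 (hXD p)
  obtain ⟨hY0, hY1, hY2⟩ := (mem_spanDist_iff ha hs hk p (Y p)).1 (hYD p)
  have hX' := fun e => frameDeriv_of_mem_spanDist ha hs hk hX hXD e p
  have hY' := fun e => frameDeriv_of_mem_spanDist ha hs hk hY hYD e p
  rw [mem_derivedDist_iff]
  simp only [lieBr_eq]
  constructor
  · simp only [fun e => (hX' e).1, fun e => (hY' e).1, Fin.sum_univ_five]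
    simp only [Fin.reduceEq, if_true, if_false, Matrix.cons_val]
    linear_combination Y p 1 * hX2 - c / a * warpCoeff a c k s p * X p 4 * hY1 - X p 1 * hY2 +
      c / a * warpCoeff a c k s p * Y p 4 * hX1
  · simp only [fun e => (hX' e).2, fun e => (hY' e).2, Fin.sum_univ_five]
    simp only [Matrix.cons_val]
    linear_combination X p 0 * hY2 - Y p 0 * hX2 - c / a * warpCoeff a c k s p * Y p 4 * hX0 +
      c / a * warpCoeff a c k s p * X p 4 * hY0

theorem smoothOn_const (v : Fin 5 → 𝕜) : SmoothOn Set.univ (fun _ : M5 => v) := fun _ =>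
  contMDiffOn_const

theorem smoothOn_X2 (ha : a ≠ 0) (hs : s ≠ 0) (hk : k ≠ 0) :
    SmoothOn Set.univ (X2 a c s (warp a c k)) := fun e => by
  rw [contMDiffOn_univ]
  simp only [X2_eq ha hs hk]
  fin_cases e
  · exact contMDiff_const
  · exact contMDiff_const
  · exact contMDiff_const
  · exact contMDiff_const
  · refine (contMDiff_const_mul (contMDiff_inv_warpCoeff (c := c) ha hs hk) (-a)).congr fun p => ?_
    simp [div_eq_mul_inv]

theorem frameDeriv_X2 (ha : a ≠ 0) (hs : s ≠ 0) (hk : k ≠ 0) (e b : Fin 5) (p : M5) :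
    frameDeriv e (fun q => X2 a c s (warp a c k) q b) p =
      if b = 4 ∧ e = 3 then -(c / warpCoeff a c k s p) else 0 := by
  have hy := warpCoeff_ne_zero (c := c) ha hk hs
  simp only [X2_eq ha hs hk]
  fin_cases b
  · simpa using frameDeriv_const e a p
  · simpa using frameDeriv_const e (0 : 𝕜) p
  · simpa using frameDeriv_const e c p
  · simpa using frameDeriv_const e (0 : 𝕜) p
  · have hyd : MDifferentiableAt IM 𝓘(ℝ, 𝕜) (warpCoeff a c k s) p :=
      (contMDiff_warpCoeff a c k s (n := 1) p).mdifferentiableAt one_ne_zero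
    -- The derivative of the last component comes from differentiating the constant product `y · X₂⁴
    -- = -a`.
    have hud : MDifferentiableAt IM 𝓘(ℝ, 𝕜) (fun q => X2 a c s (warp a c k) q 4) p :=
      (smoothOn_X2 ha hs hk).mdifferentiableAt 4 p
    have h1 := frameDeriv_mul e hyd hud
    have h2 : (fun q => warpCoeff a c k s q * X2 a c s (warp a c k) q 4) = fun _ => -a := by
      funext q
      have := hy q
      rw [X2_eq ha hs hk]
      simp
      field_simp
    rw [h2, frameDeriv_const, frameDeriv_warpCoeff] at h1
    simp only [X2_eq ha hs hk] at h1
    have h3 := hy p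
    refine mul_left_cancel₀ h3 ?_
    simp at h1 ⊢
    split_ifs at h1 ⊢ with he
    · field_simp at h1 ⊢
      linear_combination -h1
    · linear_combination -h1

theorem lieBr_X1_X2 (ha : a ≠ 0) (hs : s ≠ 0) (hk : k ≠ 0) (p : M5) :
    lieBr X1 (X2 a c s (warp a c k)) p = ![-c, 0, a, 0, c / warpCoeff a c k s p] := by
  funext e
  rw [lieBr_eq]
  have h1 : ∀ b e, frameDeriv b (fun q => (X1 q : Fin 5 → 𝕜) e) p = 0 := fun b e =>
    frameDeriv_const b _ p
  simp only [h1, frameDeriv_X2 ha hs hk]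
  simp only [X2_eq ha hs hk, Fin.sum_univ_five]
  fin_cases e <;> simp [X1]

theorem lieBr_E3 (X : M5 → Fin 5 → 𝕜) (p : M5)
    (hX : ∀ e, frameDeriv 2 (fun q => X q e) p = 0) :
    lieBr X (fun _ => Pi.single 2 1) p = ![-X p 1, X p 0, 0, 0, 0] := by
  funext e
  rw [lieBr_eq]
  have h1 : ∀ b e, frameDeriv b (fun _ : M5 => (Pi.single 2 1 : Fin 5 → 𝕜) e) p = 0 := fun b e =>
    frameDeriv_const b _ p
  simp only [h1, Fin.sum_univ_five]
  fin_cases e <;> simp [hX]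

theorem bracketDist_spanDist (ha : a ≠ 0) (hs : s ≠ 0) (hk : k ≠ 0) (hac : a ^ 2 + c ^ 2 ≠ 0) :
    bracketDist (spanDist X1 (X2 a c s (warp a c k))) (spanDist X1 (X2 a c s (warp a c k))) =
      derivedDist (warpCoeff a c k s) := by
  funext p
  have hy := warpCoeff_ne_zero (c := c) ha hk hs p
  apply le_antisymm
  · refine sup_le (fun v hv => ?_) (Submodule.span_le.2 ?_)
    · have := (mem_spanDist_iff ha hs hk p v).1 hv
      exact ⟨this.1, this.2.1⟩
    · rintro v ⟨X, Y, hX, hY, hXD, hYD, rfl⟩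
      exact lieBr_mem_derivedDist ha hs hk hX hY hXD hYD p
  · rintro v ⟨hv0, hv1⟩
    have h12 : lieBr X1 (X2 a c s (warp a c k)) p ∈
        bracketDist (spanDist X1 (X2 a c s (warp a c k))) (spanDist X1 (X2 a c s (warp a c k))) p :=
      Submodule.mem_sup_right (Submodule.subset_span ⟨X1, X2 a c s (warp a c k),
        smoothOn_const _, smoothOn_X2 ha hs hk,
        fun q => Submodule.subset_span (Set.mem_insert _ _),
        fun q => Submodule.subset_span (Set.mem_insert_of_mem _ rfl), rfl⟩)
    -- The ratio `ω₃(v) / ω₃([X₁, X₂])`; its denominator `(a² + c²) / a` is nonzero by `hac`, so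
    -- subtracting `μ [X₁, X₂]` lands in `D`.
    set μ := (v 2 + c / a * warpCoeff a c k s p * v 4) / ((a ^ 2 + c ^ 2) / a) with hμ
    have hd : v - μ • lieBr X1 (X2 a c s (warp a c k)) p ∈
        spanDist X1 (X2 a c s (warp a c k)) p := by
      have hμ' : μ * (a + c ^ 2 / a) = v 2 + c / a * warpCoeff a c k s p * v 4 := by
        rw [hμ]
        field_simp
      rw [mem_spanDist_iff ha hs hk, lieBr_X1_X2 ha hs hk]
      clear_value μ
      refine ⟨?_, ?_, ?_⟩
      · simp
        field_simp
        linear_combination hv0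
      · simpa using hv1
      · simp
        field_simp at hμ' ⊢
        linear_combination -hμ'
    have := Submodule.add_mem _ (Submodule.mem_sup_left hd) (Submodule.smul_mem _ μ h12)
    rwa [sub_add_cancel] at this

theorem finrank_spanDist (ha : a ≠ 0) (p : M5) :
    Module.finrank 𝕜 (spanDist X1 (X2 a c s (warp a c k)) p) = 2 := by
  have hli : LinearIndependent 𝕜 ![(X1 p : Fin 5 → 𝕜), X2 a c s (warp a c k) p] := by
    rw [LinearIndependent.pair_iff]
    intro x y h
    have h0 := congrFun h 0
    have h1 := congrFun h 1
    simp [X1, X2, ha] at h0 h1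
    exact ⟨h1, h0⟩
  have h := finrank_span_eq_card hli
  rwa [Matrix.range_cons, Matrix.range_cons, Matrix.range_empty, Set.union_empty,
    Set.singleton_union, Fintype.card_fin] at h

theorem finrank_derivedDist (y : M5 → 𝕜) (p : M5) :
    Module.finrank 𝕜 (derivedDist y p) = 3 := by
  have hli : LinearIndependent 𝕜 (![![y p, 0, 0, 0, -1], ![0, 1, 0, -1, 0], ![0, 0, 1, 0, 0]] :
      Fin 3 → Fin 5 → 𝕜) := by
    rw [Fintype.linearIndependent_iff]
    intro x h
    have h4 := congrFun h 4
    have h1 := congrFun h 1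
    have h2 := congrFun h 2
    simp [Fin.sum_univ_three] at h1 h2 h4
    intro i
    fin_cases i
    · exact h4
    · exact h1
    · exact h2
  have h : derivedDist y p = Submodule.span 𝕜 (Set.range
      (![![y p, 0, 0, 0, -1], ![0, 1, 0, -1, 0], ![0, 0, 1, 0, 0]] : Fin 3 → Fin 5 → 𝕜)) := by
    apply le_antisymm
    · rintro v ⟨h0, h1⟩
      rw [Submodule.mem_span_range_iff_exists_fun]
      refine ⟨![-v 4, v 1, v 2], ?_⟩
      funext i
      fin_cases i <;> simp [Fin.sum_univ_three]
      · linear_combination -h0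
      · linear_combination -h1
    · rw [Submodule.span_le]
      rintro _ ⟨i, rfl⟩
      fin_cases i <;> simp [mem_derivedDist_iff]
  rw [h, finrank_span_eq_card hli, Fintype.card_fin]

/-- The constant field `E³` is a section of `[D, D]`, with `[X₁, E³] = -E¹` and `[X₂, E³] = a E²`.
These span a complement of `ker ω₁ ∩ ker ω₂`. -/
theorem bracketDist_derivedDist (ha : a ≠ 0) (hs : s ≠ 0) (hk : k ≠ 0) (p : M5) :
    bracketDist (spanDist X1 (X2 a c s (warp a c k))) (derivedDist (warpCoeff a c k s)) p = ⊤ := by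
  rw [eq_top_iff]
  rintro v -
  set T := bracketDist (spanDist X1 (X2 a c s (warp a c k))) (derivedDist (warpCoeff a c k s)) p
  have hE : ∀ X : M5 → Fin 5 → 𝕜, SmoothOn Set.univ X →
      (∀ q, X q ∈ spanDist X1 (X2 a c s (warp a c k)) q) →
      lieBr X (fun _ => Pi.single 2 1) p ∈ T := fun X hX hXD =>
    Submodule.mem_sup_right (Submodule.subset_span ⟨X, _, hX, smoothOn_const _, hXD,
      fun q => by simp [mem_derivedDist_iff], rfl⟩)
  have h1 := hE X1 (smoothOn_const _) fun q => Submodule.subset_span (Set.mem_insert _ _)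
  have h2 := hE (X2 a c s (warp a c k)) (smoothOn_X2 ha hs hk)
    fun q => Submodule.subset_span (Set.mem_insert_of_mem _ rfl)
  have hE1 := lieBr_E3 (X1 : M5 → Fin 5 → 𝕜) p fun e => frameDeriv_const 2 _ p
  have hE2 := lieBr_E3 (X2 a c s (warp a c k)) p fun e => by rw [frameDeriv_X2 ha hs hk]; simp
  rw [hE1] at h1
  rw [hE2, X2_eq ha hs hk] at h2
  -- The multiples are `ω₁(v)` and `ω₂(v) / a`, chosen so that the corrected vector is killed by
  -- `ω₁` and `ω₂`.
  have h3 : v + (v 0 + warpCoeff a c k s p * v 4) • ![-(X1 p : Fin 5 → 𝕜) 1, X1 p 0, 0, 0, 0] -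
      ((v 1 + v 3) / a) • ![-(![a, 0, c, 0, -(a / warpCoeff a c k s p)] : Fin 5 → 𝕜) 1,
        (![a, 0, c, 0, -(a / warpCoeff a c k s p)] : Fin 5 → 𝕜) 0, 0, 0, 0] ∈ T := by
    refine Submodule.mem_sup_left ⟨?_, ?_⟩
    · simp only [X1, Pi.add_apply, Pi.sub_apply, Pi.smul_apply, smul_eq_mul, Matrix.cons_val]
      ring
    · simp only [X1, Pi.add_apply, Pi.sub_apply, Pi.smul_apply, smul_eq_mul, Matrix.cons_val]
      field_simp
      ring
  have h4 := Submodule.add_mem _ (Submodule.sub_mem _ h3 (Submodule.smul_mem _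
    (v 0 + warpCoeff a c k s p * v 4) h1)) (Submodule.smul_mem _ ((v 1 + v 3) / a) h2)
  rwa [add_sub_right_comm, add_sub_cancel_right, sub_add_cancel] at h4

theorem is235_spanDist (ha : a ≠ 0) (hs : s ≠ 0) (hk : k ≠ 0) (hac : a ^ 2 + c ^ 2 ≠ 0) :
    Is235 (spanDist X1 (X2 a c s (warp a c k))) := fun p => by
  rw [bracketDist_spanDist ha hs hk hac]
  exact ⟨finrank_spanDist ha p, finrank_derivedDist _ p,
    bracketDist_derivedDist ha hs hk p⟩

end Distribution

/-! ### The metric `gm` -/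

theorem isMetric_gm {a c k s : 𝕜} (ha : a ≠ 0) (hk : k ≠ 0) (hac : a ^ 2 + c ^ 2 ≠ 0)
    (hs : s ≠ 0) : IsMetric (gm a c s (warp a c k)) := by
  refine ⟨fun i j => ?_, fun p => ⟨?_, ?_⟩⟩
  · have h1 : ∀ i, ContMDiff IM 𝓘(ℝ, 𝕜) ∞ (frameScale a c k s 1 i) := fun i => by
      fin_cases i
      · exact contMDiff_const
      · exact contMDiff_const
      · exact contMDiff_const
      · exact contMDiff_const
      · exact contMDiff_warpCoeff a c k s
    simp only [gm_eq_metricCoeff ha]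
    exact contMDiff_const_mul ((contDiff_mul (𝕜 := ℝ) (𝔸 := 𝕜)).contMDiff.comp
      ((h1 i).prodMk_space (h1 j))) _
  · rw [gm_eq ha]
    ext i j
    fin_cases i <;> fin_cases j <;> rfl
  · have hB : coeffB a c ≠ 0 :=
      mul_ne_zero (by norm_num) (div_ne_zero (pow_ne_zero 2 ha) hac)
    -- Nondegeneracy follows from the explicit inverse, without expanding a determinant.
    have h := (isScaling_frameScale (c := c) ha hk hs one_ne_zero rfl rfl).metric_mul_inv
      (gm_eq_metricCoeff ha) (metricCoeff_inv hB _) p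
    have h2 := congrArg Matrix.det h
    rw [Matrix.det_mul, Matrix.det_one] at h2
    exact left_ne_zero_of_mul_eq_one h2

/-! ### The Cartan coframe -/

/-- The covector `u₀ σ₁ + u₁ σ₂ + u₂ σ₃ + u₃ dr + u₄ y du`. -/
def warpForm (u : Fin 5 → 𝕜) (y : 𝕜) : Fin 5 → 𝕜 := ![u 0, u 1, u 2, u 3, u 4 * y]

theorem smoothOn_warpForm (a c k s : 𝕜) (u : Fin 5 → 𝕜) (U : Set M5) :
    SmoothOn U (fun p => warpForm u (warpCoeff a c k s p)) := fun e => by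
  refine ContMDiff.contMDiffOn ?_
  fin_cases e
  · exact contMDiff_const
  · exact contMDiff_const
  · exact contMDiff_const
  · exact contMDiff_const
  · exact contMDiff_const_mul (contMDiff_warpCoeff a c k s) _

theorem frameDeriv_warpForm (a c k s : 𝕜) (u : Fin 5 → 𝕜) (e b : Fin 5) (p : M5) :
    frameDeriv e (fun q => warpForm u (warpCoeff a c k s q) b) p =
      if e = 3 ∧ b = 4 then -(c / a * u 4 * warpCoeff a c k s p) else 0 := by
  fin_cases b
  · simpa [warpForm] using frameDeriv_const e (u 0) p
  · simpa [warpForm] using frameDeriv_const e (u 1) p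
  · simpa [warpForm] using frameDeriv_const e (u 2) p
  · simpa [warpForm] using frameDeriv_const e (u 3) p
  · refine (frameDeriv_const_mul e (u 4)
      ((contMDiff_warpCoeff a c k s (n := 1) p).mdifferentiableAt one_ne_zero)).trans ?_
    rw [frameDeriv_warpCoeff]
    by_cases he : e = 3
    · simp [he]
      ring
    · simp [he]

/-- The exterior derivative of `warpForm u y` for a function `y` with `dy = -t y dr`. -/
def warpFormD (t : 𝕜) (u : Fin 5 → 𝕜) (y : 𝕜) : Fin 5 → Fin 5 → 𝕜 :=
  ![![0, u 2, -u 1, 0, 0], ![-u 2, 0, u 0, 0, 0], ![u 1, -u 0, 0, 0, 0],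
    ![0, 0, 0, 0, -(t * u 4 * y)], ![0, 0, 0, t * u 4 * y, 0]]

theorem extD_warpForm (a c k s : 𝕜) (u : Fin 5 → 𝕜) (p : M5) :
    extD (fun q => warpForm u (warpCoeff a c k s q)) p =
      warpFormD (c / a) u (warpCoeff a c k s p) := by
  funext e b
  rw [extD, frameDeriv_warpForm, frameDeriv_warpForm]
  simp only [structFun_eq, Fin.sum_univ_five]
  fin_cases e <;> fin_cases b <;> simp [structConst, warpForm, warpFormD]

/-- The coefficients of the Cartan coframe, where `m = a²/(a²+c²)`, `A = (3 + 4 m)/5` and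
`t = c/a`. -/
def cartanCoeff (m A t : 𝕜) : Fin 5 → Fin 5 → 𝕜 :=
  ![![m, 0, 0, 0, m], ![0, m, 0, m, 0], ![0, 0, m, 0, m * t], ![0, -(A / 2), 0, 1 - A / 2, 0],
    ![A / 2, 0, 0, 0, A / 2 - 1]]

/-- The coefficients of the connection forms in Cartan's structure equations. -/
def connectionCoeff (m A t : 𝕜) : Fin 7 → Fin 5 → 𝕜 :=
  let q := (m - A ^ 2 / 4) / (2 * m)
  let r := (A / 2 - m) / m
  let v := (A ^ 2 / 4 - 2 / 3 * (m - A ^ 2 / 4)) / m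
  ![0, ![0, 0, 1 - A / 2, 0, -(A / 2 * t)], ![0, 0, A / 2 - 1, 0, A / 2 * t], 0,
    ![0, q, 0, q + r, 0], ![-q, 0, 0, 0, -(q + r)], ![0, 0, v, 0, v * t]]

section StructureEquations

variable {m A t y : 𝕜} {θ : Fin 5 → Fin 5 → 𝕜} {Ω : Fin 7 → Fin 5 → 𝕜}

theorem first_structure_eq (hθ : ∀ i, θ i = warpForm (cartanCoeff m A t i) y)
    (hΩ : ∀ i, Ω i = warpForm (connectionCoeff m A t i) y) :
    warpFormD t (cartanCoeff m A t 0) y = wedge (θ 0) ((2 : 𝕜) • Ω 0 + Ω 3) + wedge (θ 1) (Ω 1)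
      + wedge (θ 2) (θ 3) := by
  simp only [hθ, hΩ]
  clear hθ hΩ
  funext i j
  fin_cases i <;> fin_cases j <;>
    simp [wedge, warpForm, warpFormD, cartanCoeff, connectionCoeff]
  all_goals ring

theorem second_structure_eq (hθ : ∀ i, θ i = warpForm (cartanCoeff m A t i) y)
    (hΩ : ∀ i, Ω i = warpForm (connectionCoeff m A t i) y) :
    warpFormD t (cartanCoeff m A t 1) y = wedge (θ 0) (Ω 2) + wedge (θ 1) (Ω 0 + (2 : 𝕜) • Ω 3)
      + wedge (θ 2) (θ 4) := by
  simp only [hθ, hΩ]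
  clear hθ hΩ
  funext i j
  fin_cases i <;> fin_cases j <;>
    simp [wedge, warpForm, warpFormD, cartanCoeff, connectionCoeff]
  all_goals ring

/-- The first two equations hold for all `m`, `A`, `t`. Here `m` is normalised: the `ω₄ ∧ ω₅` part
of `d(m ω₃)` is `m (1 + t²)`, which must be `1`. -/
theorem third_structure_eq (hm : m ≠ 0) (hmt : m * (1 + t ^ 2) = 1) (hθ : ∀ i, θ i = warpForm (cartanCoeff m A t i) y)
    (hΩ : ∀ i, Ω i = warpForm (connectionCoeff m A t i) y) :
    warpFormD t (cartanCoeff m A t 2) y = wedge (θ 0) (Ω 4) + wedge (θ 1) (Ω 5)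
      + wedge (θ 2) (Ω 0 + Ω 3) + wedge (θ 3) (θ 4) := by
  simp only [hθ, hΩ]
  clear hθ hΩ
  funext i j
  fin_cases i <;> fin_cases j <;>
    simp [wedge, warpForm, warpFormD, cartanCoeff, connectionCoeff]
  all_goals field_simp
  all_goals try ring1
  · linear_combination -16 * y * hmt
  · linear_combination 16 * y * hmt

/-- With the connection forms already chosen for the first three equations, the terms not matching
identically reduce to `5 A = 3 + 4 m`. The fifth equation gives the same condition. -/
theorem fourth_structure_eq (hm : m ≠ 0) (hA : A = (3 + 4 * m) / 5) (hθ : ∀ i, θ i = warpForm (cartanCoeff m A t i) y)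
    (hΩ : ∀ i, Ω i = warpForm (connectionCoeff m A t i) y) :
    warpFormD t (cartanCoeff m A t 3) y = wedge (θ 0) (Ω 6) + (4 / 3 : 𝕜) • wedge (θ 2) (Ω 5)
      + wedge (θ 3) (Ω 0) + wedge (θ 4) (Ω 1) := by
  simp only [hθ, hΩ]
  clear hθ hΩ
  funext i j
  fin_cases i <;> fin_cases j <;>
    simp [wedge, warpForm, warpFormD, cartanCoeff, connectionCoeff]
  all_goals field_simp
  all_goals try ring1
  · linear_combination 80 * y * hA
  · linear_combination -80 * y * hA

theorem fifth_structure_eq (hm : m ≠ 0) (hA : A = (3 + 4 * m) / 5) (hθ : ∀ i, θ i = warpForm (cartanCoeff m A t i) y)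
    (hΩ : ∀ i, Ω i = warpForm (connectionCoeff m A t i) y) :
    warpFormD t (cartanCoeff m A t 4) y = wedge (θ 1) (Ω 6) - (4 / 3 : 𝕜) • wedge (θ 2) (Ω 4)
      + wedge (θ 3) (Ω 2) + wedge (θ 4) (Ω 3) := by
  simp only [hθ, hΩ]
  clear hθ hΩ
  funext i j
  fin_cases i <;> fin_cases j <;>
    simp [wedge, warpForm, warpFormD, cartanCoeff, connectionCoeff]
  all_goals field_simp
  all_goals try ring1
  · linear_combination 80 * hA
  · linear_combination -80 * hA
  · linear_combination -80 * t * y * hA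
  · linear_combination 80 * t * y * hA

end StructureEquations

theorem linearIndependent_cartanCoeff {m A t y : 𝕜} (hm : m ≠ 0) (hy : y ≠ 0) :
    LinearIndependent 𝕜 (fun i => warpForm (cartanCoeff m A t i) y) := by
  rw [Fintype.linearIndependent_iff]
  intro x h
  have h0 := congrFun h 0
  have h1 := congrFun h 1
  have h2 := congrFun h 2
  have h3 := congrFun h 3
  have h4 := congrFun h 4
  simp only [Finset.sum_apply, Pi.smul_apply, smul_eq_mul, Fin.sum_univ_five, warpForm, cartanCoeff,
    Matrix.cons_val, Pi.zero_apply] at h0 h1 h2 h3 h4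
  have e2 : x 2 = 0 := mul_right_cancel₀ hm (by linear_combination h2)
  have e3 : x 3 = 0 := by linear_combination h3 - h1
  have e4 : x 4 = 0 := mul_right_cancel₀ hy (by
    linear_combination y * h0 - h4 + m * t * y * e2)
  have e0 : x 0 = 0 := mul_right_cancel₀ hm (by linear_combination h0 - A / 2 * e4)
  have e1 : x 1 = 0 := mul_right_cancel₀ hm (by linear_combination h1 + A / 2 * e3)
  intro i
  fin_cases i
  · exact e0
  · exact e1
  · exact e2
  · exact e3
  · exact e4

/-- The Cartan coframe `m ω₁, m ω₂, m ω₃, ω₄ - (A/2) ω₂, ω₅ + (A/2) ω₁`. -/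
def cartanCoframe (a c k s : 𝕜) (i : Fin 5) (p : M5) : Fin 5 → 𝕜 :=
  warpForm (cartanCoeff (a ^ 2 / (a ^ 2 + c ^ 2)) (coeffA a c) (c / a) i) (warpCoeff a c k s p)

/-- The connection forms of the Cartan coframe. -/
def cartanConnection (a c k s : 𝕜) (i : Fin 7) (p : M5) : Fin 5 → 𝕜 :=
  warpForm (connectionCoeff (a ^ 2 / (a ^ 2 + c ^ 2)) (coeffA a c) (c / a) i)
    (warpCoeff a c k s p)

theorem isCartanCoframe_cartanCoframe {a c k s : 𝕜} (ha : a ≠ 0) (hk : k ≠ 0)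
    (hac : a ^ 2 + c ^ 2 ≠ 0) (hs : s ≠ 0) :
    IsCartanCoframe (spanDist X1 (X2 a c s (warp a c k))) Set.univ (cartanCoframe a c k s) := by
  have hm : a ^ 2 / (a ^ 2 + c ^ 2) ≠ 0 := div_ne_zero (pow_ne_zero 2 ha) hac
  have hmt : a ^ 2 / (a ^ 2 + c ^ 2) * (1 + (c / a) ^ 2) = 1 := by field_simp
  have hA : coeffA a c = (3 + 4 * (a ^ 2 / (a ^ 2 + c ^ 2))) / 5 := by
    rw [coeffA]
    field_simp
    ring
  refine ⟨fun i => smoothOn_warpForm a c k s _ _, fun p _ =>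
    linearIndependent_cartanCoeff hm (warpCoeff_ne_zero ha hk hs p), fun p _ v => ?_,
    cartanConnection a c k s, fun i => smoothOn_warpForm a c k s _ _, fun p _ => ?_⟩
  · rw [mem_spanDist_iff ha hs hk]
    have h0 : cartanCoframe a c k s 0 p ⬝ᵥ v =
        a ^ 2 / (a ^ 2 + c ^ 2) * (v 0 + warpCoeff a c k s p * v 4) := by
      simp [cartanCoframe, warpForm, cartanCoeff, dotProduct, Fin.sum_univ_five]
      ring
    have h1 : cartanCoframe a c k s 1 p ⬝ᵥ v = a ^ 2 / (a ^ 2 + c ^ 2) * (v 1 + v 3) := by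
      simp [cartanCoframe, warpForm, cartanCoeff, dotProduct, Fin.sum_univ_five]
      ring
    have h2 : cartanCoframe a c k s 2 p ⬝ᵥ v =
        a ^ 2 / (a ^ 2 + c ^ 2) * (v 2 + c / a * warpCoeff a c k s p * v 4) := by
      simp [cartanCoframe, warpForm, cartanCoeff, dotProduct, Fin.sum_univ_five]
      ring
    rw [h0, h1, h2]
    simp only [mul_eq_zero, hm, false_or]
  · have hθ : ∀ i, extD (cartanCoframe a c k s i) p = warpFormD (c / a)
        (cartanCoeff (a ^ 2 / (a ^ 2 + c ^ 2)) (coeffA a c) (c / a) i) (warpCoeff a c k s p) :=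
      fun i => extD_warpForm a c k s _ p
    have h1 : ∀ i, cartanCoframe a c k s i p = warpForm (cartanCoeff (a ^ 2 / (a ^ 2 + c ^ 2))
        (coeffA a c) (c / a) i) (warpCoeff a c k s p) := fun _ => rfl
    have h2 : ∀ i, cartanConnection a c k s i p = warpForm (connectionCoeff
        (a ^ 2 / (a ^ 2 + c ^ 2)) (coeffA a c) (c / a) i) (warpCoeff a c k s p) := fun _ => rfl
    simp only [hθ]
    have e1 := first_structure_eq h1 h2
    have e2 := second_structure_eq h1 h2
    have e3 := third_structure_eq hm hmt h1 h2
    have e4 := fourth_structure_eq hm hA h1 h2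
    have e5 := fifth_structure_eq hm hA h1 h2
    exact ⟨e1, e2, e3, e4, e5⟩

theorem cartanMetric_warpForm (m A t : 𝕜) {y : 𝕜} {θ : Fin 5 → M5 → Fin 5 → 𝕜} {p : M5}
    (hθ : ∀ i, θ i p = warpForm (cartanCoeff m A t i) y) :
    cartanMetric θ p = m • !![A, 0, 0, 0, (A - 1) * y;
        0, A, 0, A - 1, 0;
        0, 0, 4 / 3 * m, 0, 4 / 3 * m * t * y;
        0, A - 1, 0, A - 2, 0;
        (A - 1) * y, 0, 4 / 3 * m * t * y, 0, (A - 2 + 4 / 3 * m * t ^ 2) * y ^ 2] := by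
  simp only [cartanMetric, hθ]
  ext i j
  simp only [Matrix.add_apply, Matrix.sub_apply, Matrix.smul_apply, symProd, Matrix.of_apply]
  fin_cases i <;> fin_cases j <;> simp [warpForm, cartanCoeff, -mul_eq_mul_left_iff] <;> ring

/-- One global coframe works, so `U` is all of `M`. Its Cartan metric is `m` times `gm` with `m = a²
/ s²`, hence the constant factor `φ = s / a`. -/
theorem representsNurowski_gm {a c k s : 𝕜} (ha : a ≠ 0) (hk : k ≠ 0) (hac : a ^ 2 + c ^ 2 ≠ 0)
    (hs : s ^ 2 = a ^ 2 + c ^ 2) :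
    RepresentsNurowski (spanDist X1 (X2 a c s (warp a c k))) (gm a c s (warp a c k)) := by
  have hs0 : s ≠ 0 := fun h => hac (by rw [← hs, h, zero_pow two_ne_zero])
  refine ⟨isMetric_gm ha hk hac hs0, fun p₀ => ⟨Set.univ, isOpen_univ, Set.mem_univ _,
    cartanCoframe a c k s, isCartanCoframe_cartanCoframe ha hk hac hs0, fun _ => s / a,
    contMDiffOn_const, fun p _ => ⟨div_ne_zero hs0 ha, ?_⟩⟩⟩
  have h := cartanMetric_warpForm (a ^ 2 / (a ^ 2 + c ^ 2)) (coeffA a c) (c / a)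
    (y := warpCoeff a c k s p) (θ := cartanCoframe a c k s) (p := p) fun _ => rfl
  rw [h, gm_eq ha, smul_smul,
    show (s / a) ^ 2 * (a ^ 2 / (a ^ 2 + c ^ 2)) = 1 by rw [div_pow, hs]; field_simp, one_smul]
  rfl

end SU2Pfaffian

end

/-! ### Assembly of the four claims. -/

open SU2Pfaffian in
theorem mainTheorem1 {𝕜 : Type*} [RCLike 𝕜] (a₂ c₂ k s : 𝕜) (ha : a₂ ≠ 0) (hk : k ≠ 0)
    (hac : a₂ ^ 2 + c₂ ^ 2 ≠ 0) (hs : s ^ 2 = a₂ ^ 2 + c₂ ^ 2) :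
    IsNullField (productMetric (warp a₂ c₂ k)) X1 ∧
    IsNullField (productMetric (warp a₂ c₂ k)) (X2 a₂ c₂ s (warp a₂ c₂ k)) ∧
    Is235 (spanDist X1 (X2 a₂ c₂ s (warp a₂ c₂ k))) ∧
    RepresentsNurowski (spanDist X1 (X2 a₂ c₂ s (warp a₂ c₂ k)))
      (gm a₂ c₂ s (warp a₂ c₂ k)) ∧
    ((∀ (a b c d : Fin 5) (p : M5), weyl (gm a₂ c₂ s (warp a₂ c₂ k)) a b c d p = 0) ↔
      9 * a₂ ^ 2 + c₂ ^ 2 = 0 ∨ a₂ ^ 2 + 9 * c₂ ^ 2 = 0) := by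
  have hs0 : s ≠ 0 := fun h => hac (by rw [← hs, h, zero_pow two_ne_zero])
  refine ⟨isNullField_X1 _, isNullField_X2 ha hs (warp_ne_zero hk), is235_spanDist ha hs0 hk hac,
    representsNurowski_gm ha hk hac hs, fun h => ?_, fun h e b d f p => ?_⟩
  -- A single component at a single point suffices, since `y` vanishes nowhere.
  · have h1 := h 0 4 1 3 (1, 0, 0)
    rw [weyl_gm_eq ha hk hac hs0] at h1
    have h2 := (mul_eq_zero.1 h1).resolve_right (warpCoeff_ne_zero ha hk hs0 _)
    rw [div_eq_zero_iff, mul_eq_zero] at h2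
    exact h2.resolve_right (by simp [ha, hac])
  · rcases h with h | h
    -- The hypothesis itself supplies the root of `-1`: `9a² + c² = 0` says that `c / (3a)` squares
    -- to `-1`. In the other case `3c / a` does.
    · refine weyl_gm_eq_zero (i := c₂ / (3 * a₂)) ha hk hs0 ?_ (Or.inl ?_) e b d f p
      · field_simp
        linear_combination h
      · field_simp
    · refine weyl_gm_eq_zero (i := 3 * c₂ / a₂) ha hk hs0 ?_ (Or.inr ?_) e b d f p
      · field_simp
        linear_combination h
      · field_simp
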